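/- **Setting.** Let $\mathcal V$ be a category with finite products, pullbacks and all small coproducts that is cartesian closed, with internal hom $[-,-]$ and terminal object $*$, and that is extensive: for every small family $(X_i)_{i\in I}$ of objects the coproduct functor $\prod_{i}\mathcal V/X_i\to\mathcal V/\coprod_i X_i$ is an equivalence. Let $\mathcal C$ be a $\mathcal V$-category with a set of objects, with composition $c$ and identities $i_A:*\to\mathcal C(A,A)$, let $F:\mathcal C^{\mathrm{op}}\to\mathcal V$ be a $\mathcal V$-functor, and write $\mathrm{ev}_{A,B}:\mathcal C(A,B)\times FB\to FA$ for the transpose of its action on hom-objects. * *Representability.* Let $C\in\mathcal C$ and $x:*\to FC$. There is a unique $\mathcal V$-natural transformation $\alpha_x:\mathcal C(-,C)\Rightarrow F$ such that the composite $*\xrightarrow{i_C}\mathcal C(C,C)\xrightarrow{(\alpha_x)_C}FC$ equals $x$. The $\mathcal V$-functor $F$ is *$\mathcal V$-representable by $(C,x)$* if $\alpha_x$ is a $\mathcal V$-natural isomorphism. * *Internal category of elements.* $\int_{\mathcal C}F$ is the internal category in $\mathcal V$ with object of objects $\coprod_A FA$ and object of morphisms $\coprod_{A,B}\mathcal C(A,B)\times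 FB$. Its source map is induced by the maps $\mathrm{ev}_{A,B}$, its target map by the projections $\mathcal C(A,B)\times FB\to FB$, its identity map by the $i_A$, and its composition, on the object of composable pairs $\coprod_{A,B,D}\mathcal C(A,B)\times\mathcal C(B,D)\times FD$, by $c\times\mathrm{id}$. The pair $(C,x)$ gives an element $(C,x):*\to\int_{\mathcal C}F$, that is, an internal functor from the terminal internal category. * *Generalized elements.* For $X\in\mathcal V$ let $\mathrm{cst}\,X$ be the internal category whose objects of objects and of morphisms are $X$ and all of whose structure maps are the evident identities or isomorphisms. For an internal category $\mathbb A$ let $[\![\mathrm{cst}\,X,\mathbb A]\!]$ be the internal hom in the category $\mathrm{Cat}(\mathcal V)$ of internal categories; its objects of objects and of morphisms are $[X,\mathbb A_0]$ and $[X,\mathbb A_1]$. * *Underlying $\mathcal V$-category.* For an internal category $\mathbb A$ in $\mathcal V$, $\mathrm{Und}\,\mathbb A$ is the $\mathcal V$-category whose objects are the maps $*\to\mathbb A_0$ and whose hom-object from $a$ to $b$ is the pullback of $(s,t):\mathbb A_1\to\mathbb A_0\times\mathbb A_0$ along $(a,b):*\to\mathbb A_0\times\mathbb A_0$, with composition and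 identities induced by those of $\mathbb A$. An element $T:*\to\mathbb A$ is regarded as an object of $\mathrm{Und}[\![\mathrm{cst}\,X,\mathbb A]\!]$ through the composite $*\xrightarrow{T}\mathbb A\xrightarrow{!^*}[\![\mathrm{cst}\,X,\mathbb A]\!]$, where $!^*$ is induced by $\mathrm{cst}\,X\to *$. * *$\mathcal V$-terminal objects.* An object $T$ of a $\mathcal V$-category $\mathcal D$ is *$\mathcal V$-terminal* if $\mathcal D(A,T)\to *$ is an isomorphism for every object $A$ of $\mathcal D$. * *Conservative families.* A family $\mathcal G$ of objects of $\mathcal V$ is *conservative* if a map $f:Y\to Z$ of $\mathcal V$ is an isomorphism if and only if $f_*:\mathcal V(X,Y)\to\mathcal V(X,Z)$ is a bijection for every $X\in\mathcal G$. **Theorem.** Let $\mathcal G$ be a conservative family of objects of $\mathcal V$, let $F:\mathcal C^{\mathrm{op}}\to\mathcal V$ be a $\mathcal V$-functor, and let $(C,x)$ be a pair of an object $C\in\mathcal C$ and an element $x:*\to FC$. The following are equivalent: (i) the $\mathcal V$-functor $F$ is $\mathcal V$-representable by $(C,x)$; (ii) for every object $X\in\mathcal G$, the pair $(C,x)$ is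 a $\mathcal V$-terminal object of the $\mathcal V$-category of generalized elements $\mathrm{Und}[\![\mathrm{cst}\,X,\int_{\mathcal C}F]\!]$. -/

import Mathlib

open CategoryTheory Limits MonoidalCategory CartesianMonoidalCategory Opposite
open scoped MonoidalClosed

attribute [local instance 2000] CategoryStruct.toQuiver

universe w v u w'

namespace VRep

section Extensive

variable {V : Type u} [Category.{v} V] [HasCoproducts.{w} V]

/-- The functor `∏ᵢ V/Xᵢ ⥤ V/∐ᵢ Xᵢ` taking a family of maps to its coproduct. -/
noncomputable def sigmaOver {I : Type w} (X : I → V) : (∀ i, Over (X i)) ⥤ Over (∐ X) where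
  obj Y := Over.mk (Limits.Sigma.map fun i => (Y i).hom)
  map f := Over.homMk (Limits.Sigma.map fun i => (f i).left)

variable (V) in
/-- A category with small coproducts is extensive if each functor
`∏ᵢ V/Xᵢ ⥤ V/∐ᵢ Xᵢ` is an equivalence of categories. -/
class IsExtensive : Prop where
  isEquivalence : ∀ (I : Type w) (X : I → V), (sigmaOver X).IsEquivalence

variable [IsExtensive.{w} V] {I : Type w} {Y : I → V}

theorem exists_cover {X : V} (f : X ⟶ ∐ Y) :
    ∃ (Z : I → V) (z : ∀ i, Z i ⟶ X) (g : ∀ i, Z i ⟶ Y i),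
      (∀ i, z i ≫ f = g i ≫ Sigma.ι Y i) ∧ Nonempty (IsColimit (Cofan.mk X z)) := by
  have := IsExtensive.isEquivalence I Y
  let W := (sigmaOver Y).objPreimage (Over.mk f)
  let e : (sigmaOver Y).obj W ≅ Over.mk f := (sigmaOver Y).objObjPreimageIso (Over.mk f)
  let e' : (∐ fun i => (W i).left) ≅ X := (Over.forget _).mapIso e
  have he : e'.hom ≫ f = Limits.Sigma.map fun i => (W i).hom := Over.w e.hom
  refine ⟨fun i => (W i).left, fun i => Sigma.ι (fun i => (W i).left) i ≫ e'.hom,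
    fun i => (W i).hom, fun i => ?_, ⟨?_⟩⟩
  · rw [Category.assoc, he, Sigma.ι_map]
  · exact IsColimit.ofIsoColimit (coproductIsCoproduct fun i => (W i).left)
      (Cofan.ext e' (fun i => rfl))

theorem hom_ext_of_cover {X T : V} (f : X ⟶ ∐ Y) {a b : X ⟶ T}
    (H : ∀ (i : I) (Z : V) (z : Z ⟶ X) (g : Z ⟶ Y i), z ≫ f = g ≫ Sigma.ι Y i →
      z ≫ a = z ≫ b) : a = b := by
  obtain ⟨Z, z, g, h, ⟨hc⟩⟩ := exists_cover f
  exact Cofan.IsColimit.hom_ext hc _ _ fun i => H i _ _ _ (h i)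

theorem exists_lift_of_cover {X Q S : V} (f : X ⟶ ∐ Y) (p : Q ⟶ S) (a : X ⟶ S)
    (H : ∀ (i : I) (Z : V) (z : Z ⟶ X) (g : Z ⟶ Y i), z ≫ f = g ≫ Sigma.ι Y i →
      ∃ k : Z ⟶ Q, k ≫ p = z ≫ a) : ∃ k : X ⟶ Q, k ≫ p = a := by
  obtain ⟨Z, z, g, h, ⟨hc⟩⟩ := exists_cover f
  choose k hk using fun i => H i _ _ _ (h i)
  refine ⟨Cofan.IsColimit.desc hc k, Cofan.IsColimit.hom_ext hc _ _ fun i => ?_⟩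
  have := Cofan.IsColimit.fac hc k i
  simp only [Cofan.inj] at this ⊢
  rw [← Category.assoc, this, hk]; rfl

theorem exists_section {W : V} {i j : I} (a : W ⟶ Y i) (b : W ⟶ Y j)
    (h : a ≫ Sigma.ι Y i = b ≫ Sigma.ι Y j) :
    ∃ s : W ⟶ ∐ (fun _ : ULift.{w} (PLift (i = j)) => W),
      s ≫ Sigma.desc (fun _ => 𝟙 W) = 𝟙 W ∧
      s ≫ Sigma.desc (fun p => b ≫ eqToHom (congrArg Y p.down.down.symm)) = a := by
  have := IsExtensive.isEquivalence I Y
  let P (i k : I) : V := ∐ (fun _ : ULift.{w} (PLift (k = i)) => W)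
  let n (i : I) : W ⟶ P i i := Sigma.ι (fun _ : ULift.{w} (PLift (i = i)) => W) ⟨⟨rfl⟩⟩
  let o (i k : I) : P i k ⟶ W := Sigma.desc fun _ => 𝟙 W
  let d (i : I) (a : W ⟶ Y i) (k : I) : P i k ⟶ Y k :=
    Sigma.desc (fun p => a ≫ eqToHom (congrArg Y p.down.down.symm))
  have hnd (i : I) (a : W ⟶ Y i) : n i ≫ d i a i = a := by simp [n, d]
  have hod (i k : I) (a : W ⟶ Y i) : o i k ≫ a ≫ Sigma.ι Y i = d i a k ≫ Sigma.ι Y k := by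
    refine Sigma.hom_ext _ _ fun p => ?_
    obtain ⟨⟨rfl⟩⟩ := p
    simp [o, d]
  have hno (i : I) : n i ≫ o i i = 𝟙 W := by simp [n, o]
  let r (i : I) : W ⟶ ∐ P i := n i ≫ Sigma.ι (P i) i
  let q (i : I) : ∐ P i ⟶ W := Sigma.desc (o i)
  have hr (i : I) (a : W ⟶ Y i) : r i ≫ Limits.Sigma.map (d i a) = a ≫ Sigma.ι Y i := by
    simp only [r, Category.assoc, Sigma.ι_map]
    rw [reassoc_of% (hnd i a)]
  have hq (i : I) (a : W ⟶ Y i) : q i ≫ a ≫ Sigma.ι Y i = Limits.Sigma.map (d i a) := by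
    refine Sigma.hom_ext _ _ fun k => ?_
    simp only [q, Sigma.ι_map, Sigma.ι_desc_assoc, hod]
  have hm : (q i ≫ r j) ≫ Limits.Sigma.map (d j b) = Limits.Sigma.map (d i a) := by
    rw [Category.assoc, hr, ← h, hq]
  let D (i : I) (a : W ⟶ Y i) : ∀ k, Over (Y k) := fun k => Over.mk (d i a k)
  let m : (sigmaOver Y).obj (D i a) ⟶ (sigmaOver Y).obj (D j b) :=
    Over.homMk (q i ≫ r j) hm
  obtain ⟨φ, hφ⟩ := (sigmaOver Y).map_surjective m
  let f (k : I) : P i k ⟶ P j k := (φ k).left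
  have hf : Limits.Sigma.map f = q i ≫ r j := congrArg (fun t => t.left) hφ
  have hw : f i ≫ d j b i = d i a i := Over.w (φ i)
  refine ⟨n i ≫ f i, ?_, ?_⟩
  · have h1 : (n i ≫ f i) ≫ o j i = r i ≫ Limits.Sigma.map f ≫ q j := by simp [r, q]
    refine h1.trans ?_
    rw [hf]
    simp only [r, q, Category.assoc, Sigma.ι_desc, Sigma.ι_desc_assoc, hno]
    rw [reassoc_of% (hno i)]
  · exact (Category.assoc _ _ _).trans ((congrArg (n i ≫ ·) hw).trans (hnd i a))

theorem sigma_ι_cancel {W : V} {i : I} {a b : W ⟶ Y i}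
    (h : a ≫ Sigma.ι Y i = b ≫ Sigma.ι Y i) : a = b := by
  obtain ⟨s, h1, h2⟩ := exists_section a b h
  have h3 : Sigma.desc (fun p : ULift.{w} (PLift (i = i)) =>
      b ≫ eqToHom (congrArg Y p.down.down.symm)) = Sigma.desc (fun _ => 𝟙 W) ≫ b :=
    Sigma.hom_ext _ _ fun p => by simp
  rw [← h2, h3, reassoc_of% h1]

theorem sigma_ι_disjoint [CartesianMonoidalCategory V] [MonoidalClosed V] {W : V} {i j : I}
    (hij : i ≠ j) {a : W ⟶ Y i} {b : W ⟶ Y j} (h : a ≫ Sigma.ι Y i = b ≫ Sigma.ι Y j)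
    {T : V} : Nonempty (Unique (W ⟶ T)) := by
  obtain ⟨s, -, -⟩ := exists_section a b h
  have : IsEmpty (ULift.{w} (PLift (i = j))) := ⟨fun p => hij p.down.down⟩
  have t : IsInitial (∐ (fun _ : ULift.{w} (PLift (i = j)) => W)) :=
    IsInitial.ofUniqueHom (fun _ => Sigma.desc fun p => isEmptyElim p)
      (fun _ _ => Sigma.hom_ext _ _ fun p => isEmptyElim p)
  have := strict_initial t s
  have t' : IsInitial W := t.ofIso (asIso s).symm
  exact ⟨⟨⟨t'.to T⟩, fun _ => t'.hom_ext _ _⟩⟩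

end Extensive

section Internal

attribute [local simp] pullback.lift_fst pullback.lift_snd pullback.lift_fst_assoc
  pullback.lift_snd_assoc

variable (V : Type u) [Category.{v} V] [HasPullbacks V]

/-- An internal category in `V`; composition is written in diagrammatic order. -/
structure InternalCat where
  /-- the object of objects -/
  ob : V
  /-- the object of morphisms -/
  mor : V
  /-- the source map -/
  src : mor ⟶ ob
  /-- the target map -/
  tgt : mor ⟶ ob
  /-- the composition map, on the object of composable pairs -/
  comp : pullback tgt src ⟶ mor
  /-- the identity map -/
  ident : ob ⟶ mor
  ident_src : ident ≫ src = 𝟙 ob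
  ident_tgt : ident ≫ tgt = 𝟙 ob
  comp_src : comp ≫ src = pullback.fst tgt src ≫ src
  comp_tgt : comp ≫ tgt = pullback.snd tgt src ≫ tgt
  ident_comp : pullback.lift (src ≫ ident) (𝟙 mor)
    (by rw [Category.assoc, ident_tgt, Category.comp_id, Category.id_comp]) ≫ comp = 𝟙 mor
  comp_ident : pullback.lift (𝟙 mor) (tgt ≫ ident)
    (by rw [Category.assoc, ident_src, Category.comp_id, Category.id_comp]) ≫ comp = 𝟙 mor
  -- the object of composable triples is presented as the pairs of composable pairs
  -- `((f, g), (g, h))`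
  assoc :
    pullback.lift
      (pullback.fst (pullback.snd tgt src) (pullback.fst tgt src) ≫ comp)
      (pullback.snd (pullback.snd tgt src) (pullback.fst tgt src) ≫ pullback.snd tgt src)
      (by rw [Category.assoc, comp_tgt, Category.assoc, ← pullback.condition (f := tgt),
            pullback.condition_assoc]) ≫ comp =
    pullback.lift
      (pullback.fst (pullback.snd tgt src) (pullback.fst tgt src) ≫ pullback.fst tgt src)
      (pullback.snd (pullback.snd tgt src) (pullback.fst tgt src) ≫ comp)
      (by rw [Category.assoc, Category.assoc, comp_src, pullback.condition (f := tgt),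
            pullback.condition_assoc]) ≫ comp

variable {V}

namespace InternalCat

attribute [simp] ident_src ident_tgt

@[simp] theorem ident_src_assoc (A : InternalCat V) {Z : V} (f : A.ob ⟶ Z) :
    A.ident ≫ A.src ≫ f = f := by rw [← Category.assoc, ident_src, Category.id_comp]

@[simp] theorem ident_tgt_assoc (A : InternalCat V) {Z : V} (f : A.ob ⟶ Z) :
    A.ident ≫ A.tgt ≫ f = f := by rw [← Category.assoc, ident_tgt, Category.id_comp]

variable (A B : InternalCat V)

/-- The composite of two composable generalized elements of the object of morphisms. -/
noncomputable def compose {X : V} (f g : X ⟶ A.mor) (h : f ≫ A.tgt = g ≫ A.src) : X ⟶ A.mor :=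
  pullback.lift f g h ≫ A.comp

variable {A B}

theorem comp_eq_compose : A.comp =
    A.compose (pullback.fst A.tgt A.src) (pullback.snd A.tgt A.src) pullback.condition := by
  have : pullback.lift (pullback.fst A.tgt A.src) (pullback.snd A.tgt A.src)
      pullback.condition = 𝟙 _ := by ext <;> simp
  rw [compose, this, Category.id_comp]

theorem compose_src {X : V} (f g : X ⟶ A.mor) (h : f ≫ A.tgt = g ≫ A.src) :
    A.compose f g h ≫ A.src = f ≫ A.src := by
  rw [compose, Category.assoc, A.comp_src, pullback.lift_fst_assoc]

theorem compose_tgt {X : V} (f g : X ⟶ A.mor) (h : f ≫ A.tgt = g ≫ A.src) :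
    A.compose f g h ≫ A.tgt = g ≫ A.tgt := by
  rw [compose, Category.assoc, A.comp_tgt, pullback.lift_snd_assoc]

theorem comp_compose {X Y : V} (z : Y ⟶ X) (f g : X ⟶ A.mor) (h : f ≫ A.tgt = g ≫ A.src) :
    z ≫ A.compose f g h = A.compose (z ≫ f) (z ≫ g)
      (by rw [Category.assoc, Category.assoc, h]) := by
  rw [compose, compose, ← Category.assoc]
  congr 1
  ext <;> simp

theorem compose_congr {X : V} {f g f' g' : X ⟶ A.mor} (hf : f = f') (hg : g = g')
    (h : f ≫ A.tgt = g ≫ A.src) :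
    A.compose f g h = A.compose f' g' (by rw [← hf, ← hg, h]) := by
  subst hf hg; rfl

theorem ident_compose {X : V} (f : X ⟶ A.mor) :
    A.compose (f ≫ A.src ≫ A.ident) f (by simp) = f := by
  refine Eq.trans ?_ ((congrArg (f ≫ ·) A.ident_comp).trans (Category.comp_id f))
  refine Eq.trans ?_ (Category.assoc _ _ _)
  refine congrArg (· ≫ A.comp) ?_
  ext <;> simp

theorem compose_ident {X : V} (f : X ⟶ A.mor) :
    A.compose f (f ≫ A.tgt ≫ A.ident) (by simp) = f := by
  refine Eq.trans ?_ ((congrArg (f ≫ ·) A.comp_ident).trans (Category.comp_id f))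
  refine Eq.trans ?_ (Category.assoc _ _ _)
  refine congrArg (· ≫ A.comp) ?_
  ext <;> simp

theorem compose_assoc {X : V} (f g k : X ⟶ A.mor) (h : f ≫ A.tgt = g ≫ A.src)
    (h' : g ≫ A.tgt = k ≫ A.src) :
    A.compose (A.compose f g h) k (by rw [compose_tgt, h']) =
      A.compose f (A.compose g k h') (by rw [compose_src, h]) := by
  let t : X ⟶ pullback (pullback.snd A.tgt A.src) (pullback.fst A.tgt A.src) :=
    pullback.lift (pullback.lift f g h) (pullback.lift g k h') (by simp)
  have := congrArg (t ≫ ·) A.assoc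
  simp only [← Category.assoc] at this
  refine Eq.trans ?_ (this.trans ?_)
  · rw [compose]
    congr 1
    ext <;> simp [t, compose]
  · rw [compose]
    congr 1
    ext <;> simp [t, compose]

end InternalCat

/-- An internal functor. -/
@[ext]
structure InternalFunctor (A B : InternalCat V) where
  /-- the map on objects -/
  onOb : A.ob ⟶ B.ob
  /-- the map on morphisms -/
  onMor : A.mor ⟶ B.mor
  map_src : onMor ≫ B.src = A.src ≫ onOb
  map_tgt : onMor ≫ B.tgt = A.tgt ≫ onOb
  map_ident : A.ident ≫ onMor = onOb ≫ B.ident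
  map_comp : A.comp ≫ onMor =
    pullback.lift (pullback.fst A.tgt A.src ≫ onMor) (pullback.snd A.tgt A.src ≫ onMor)
      (by rw [Category.assoc, Category.assoc, map_src, map_tgt, pullback.condition_assoc]) ≫
      B.comp

namespace InternalFunctor

variable {A B C : InternalCat V}

theorem compose_onMor (H : InternalFunctor A B) {X : V} (f g : X ⟶ A.mor)
    (h : f ≫ A.tgt = g ≫ A.src) :
    A.compose f g h ≫ H.onMor = B.compose (f ≫ H.onMor) (g ≫ H.onMor)
      (by rw [Category.assoc, Category.assoc, H.map_src, H.map_tgt, reassoc_of% h]) := by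
  rw [InternalCat.compose, Category.assoc, H.map_comp, InternalCat.compose, ← Category.assoc]
  congr 1
  ext <;> simp

/-- The identity internal functor. -/
@[simps] def id (A : InternalCat V) : InternalFunctor A A where
  onOb := 𝟙 _
  onMor := 𝟙 _
  map_src := by simp
  map_tgt := by simp
  map_ident := by simp
  map_comp := by
    rw [Category.comp_id]
    conv_lhs => rw [A.comp_eq_compose]
    simp [InternalCat.compose]

/-- The composite of internal functors. -/
@[simps] def comp (H : InternalFunctor A B) (K : InternalFunctor B C) : InternalFunctor A C where
  onOb := H.onOb ≫ K.onOb
  onMor := H.onMor ≫ K.onMor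
  map_src := by rw [Category.assoc, K.map_src, reassoc_of% H.map_src]
  map_tgt := by rw [Category.assoc, K.map_tgt, reassoc_of% H.map_tgt]
  map_ident := by rw [reassoc_of% H.map_ident, K.map_ident, Category.assoc]
  map_comp := by
    rw [← Category.assoc]
    conv_lhs => rw [A.comp_eq_compose, H.compose_onMor, K.compose_onMor]
    simp [InternalCat.compose]

end InternalFunctor

/-- The category `Cat(V)` of internal categories in `V`. -/
instance : Category (InternalCat V) where
  Hom := InternalFunctor
  id := InternalFunctor.id
  comp := InternalFunctor.comp
  id_comp _ := InternalFunctor.ext (Category.id_comp _) (Category.id_comp _)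
  comp_id _ := InternalFunctor.ext (Category.comp_id _) (Category.comp_id _)
  assoc _ _ _ := InternalFunctor.ext (Category.assoc _ _ _) (Category.assoc _ _ _)

namespace InternalCat

theorem hom_ext {A B : InternalCat V} {H K : A ⟶ B} (h₀ : H.onOb = K.onOb)
    (h₁ : H.onMor = K.onMor) : H = K := InternalFunctor.ext h₀ h₁

@[simp] theorem id_onOb (A : InternalCat V) : (𝟙 A : A ⟶ A).onOb = 𝟙 A.ob := rfl
@[simp] theorem id_onMor (A : InternalCat V) : (𝟙 A : A ⟶ A).onMor = 𝟙 A.mor := rfl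
@[simp] theorem comp_onOb {A B C : InternalCat V} (H : A ⟶ B) (K : B ⟶ C) :
    (H ≫ K).onOb = H.onOb ≫ K.onOb := rfl
@[simp] theorem comp_onMor {A B C : InternalCat V} (H : A ⟶ B) (K : B ⟶ C) :
    (H ≫ K).onMor = H.onMor ≫ K.onMor := rfl

/-- Associativity of composition may be checked on generalized elements. -/
theorem assoc_of_forall {ob mor : V} {src tgt : mor ⟶ ob} {comp : pullback tgt src ⟶ mor}
    (H : ∀ (X : V) (f g k : X ⟶ mor) (h : f ≫ tgt = g ≫ src) (h' : g ≫ tgt = k ≫ src)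
      (h₁ : (pullback.lift f g h ≫ comp) ≫ tgt = k ≫ src)
      (h₂ : f ≫ tgt = (pullback.lift g k h' ≫ comp) ≫ src),
      pullback.lift (pullback.lift f g h ≫ comp) k h₁ ≫ comp =
        pullback.lift f (pullback.lift g k h' ≫ comp) h₂ ≫ comp)
    {p : pullback (pullback.snd tgt src) (pullback.fst tgt src) ⟶ pullback tgt src}
    {q : pullback (pullback.snd tgt src) (pullback.fst tgt src) ⟶ pullback tgt src}
    (hp : p = pullback.fst _ _) (hq : q = pullback.snd _ _)
    (h₁ : (p ≫ comp) ≫ tgt = (q ≫ pullback.snd tgt src) ≫ src)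
    (h₂ : (p ≫ pullback.fst tgt src) ≫ tgt = (q ≫ comp) ≫ src) :
    pullback.lift (p ≫ comp) (q ≫ pullback.snd tgt src) h₁ ≫ comp =
      pullback.lift (p ≫ pullback.fst tgt src) (q ≫ comp) h₂ ≫ comp := by
  have hpq : p ≫ pullback.snd tgt src = q ≫ pullback.fst tgt src := by
    rw [hp, hq, pullback.condition]
  have hp' : pullback.lift (p ≫ pullback.fst tgt src) (p ≫ pullback.snd tgt src)
      (by simp [pullback.condition]) = p := by ext <;> simp
  have hq' : pullback.lift (p ≫ pullback.snd tgt src) (q ≫ pullback.snd tgt src)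
      (by rw [hpq, Category.assoc, Category.assoc, pullback.condition]) = q := by
    ext <;> simp [hpq]
  have := H _ (p ≫ pullback.fst tgt src) (p ≫ pullback.snd tgt src) (q ≫ pullback.snd tgt src)
    (by simp [pullback.condition])
    (by rw [hpq, Category.assoc, Category.assoc, pullback.condition])
    (by rw [hp', h₁]) (by rw [hq', h₂])
  simpa only [hp', hq'] using this

/-- The internal category constant at an object. -/
noncomputable def cst (X : V) : InternalCat V where
  ob := X
  mor := X
  src := 𝟙 X
  tgt := 𝟙 X
  comp := pullback.fst (𝟙 X) (𝟙 X)
  ident := 𝟙 X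
  ident_src := Category.comp_id _
  ident_tgt := Category.comp_id _
  comp_src := rfl
  comp_tgt := pullback.condition
  ident_comp := by simp
  comp_ident := by simp
  assoc := by simp

end InternalCat

end Internal

section Cartesian

attribute [local simp] pullback.lift_fst pullback.lift_snd pullback.lift_fst_assoc
  pullback.lift_snd_assoc

variable {V : Type u} [Category.{v} V] [HasPullbacks V] [CartesianMonoidalCategory V]

namespace InternalCat

/-- The composition map of the product of two internal categories. -/
noncomputable def prodComp (A B : InternalCat V) :
    pullback (A.tgt ⊗ₘ B.tgt) (A.src ⊗ₘ B.src) ⟶ A.mor ⊗ B.mor := lift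
  (A.compose (pullback.fst (A.tgt ⊗ₘ B.tgt) (A.src ⊗ₘ B.src) ≫ fst _ _)
    (pullback.snd (A.tgt ⊗ₘ B.tgt) (A.src ⊗ₘ B.src) ≫ fst _ _)
    (by simpa using pullback.condition (f := A.tgt ⊗ₘ B.tgt) (g := A.src ⊗ₘ B.src) =≫ fst _ _))
  (B.compose (pullback.fst (A.tgt ⊗ₘ B.tgt) (A.src ⊗ₘ B.src) ≫ snd _ _)
    (pullback.snd (A.tgt ⊗ₘ B.tgt) (A.src ⊗ₘ B.src) ≫ snd _ _)
    (by simpa using pullback.condition (f := A.tgt ⊗ₘ B.tgt) (g := A.src ⊗ₘ B.src) =≫ snd _ _))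

theorem lift_prodComp (A B : InternalCat V) {X : V} (f g : X ⟶ A.mor ⊗ B.mor)
    (h : f ≫ (A.tgt ⊗ₘ B.tgt) = g ≫ (A.src ⊗ₘ B.src)) :
    pullback.lift f g h ≫ prodComp A B = lift
      (A.compose (f ≫ fst _ _) (g ≫ fst _ _) (by simpa using h =≫ fst _ _))
      (B.compose (f ≫ snd _ _) (g ≫ snd _ _) (by simpa using h =≫ snd _ _)) := by
  ext
  · rw [prodComp, Category.assoc, lift_fst, lift_fst, comp_compose]
    exact compose_congr (by simp) (by simp) _
  · rw [prodComp, Category.assoc, lift_snd, lift_snd, comp_compose]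
    exact compose_congr (by simp) (by simp) _

/-- The product of two internal categories, formed levelwise. -/
noncomputable def prod (A B : InternalCat V) : InternalCat V where
  ob := A.ob ⊗ B.ob
  mor := A.mor ⊗ B.mor
  src := A.src ⊗ₘ B.src
  tgt := A.tgt ⊗ₘ B.tgt
  ident := A.ident ⊗ₘ B.ident
  comp := prodComp A B
  ident_src := by ext <;> simp
  ident_tgt := by ext <;> simp
  comp_src := by ext <;> simp [prodComp, compose_src]
  comp_tgt := by ext <;> simp [prodComp, compose_tgt]
  ident_comp := by
    rw [lift_prodComp]
    ext
    · simpa using A.ident_compose (fst A.mor B.mor)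
    · simpa using B.ident_compose (snd A.mor B.mor)
  comp_ident := by
    rw [lift_prodComp]
    ext
    · simpa using A.compose_ident (fst A.mor B.mor)
    · simpa using B.compose_ident (snd A.mor B.mor)
  assoc := by
    refine assoc_of_forall (fun X f g k h h' h₁ h₂ => ?_) rfl rfl _ _
    simp only [lift_prodComp]
    ext <;> simp only [lift_fst, lift_snd] <;> exact compose_assoc _ _ _ _ _

/-- The first projection. -/
@[simps] noncomputable def prodFst (A B : InternalCat V) : InternalFunctor (A.prod B) A where
  onOb := fst A.ob B.ob
  onMor := fst A.mor B.mor
  map_src := by simp [prod]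
  map_tgt := by simp [prod]
  map_ident := by simp [prod]
  map_comp := by simp [prod, prodComp, compose]

/-- The second projection. -/
@[simps] noncomputable def prodSnd (A B : InternalCat V) : InternalFunctor (A.prod B) B where
  onOb := snd A.ob B.ob
  onMor := snd A.mor B.mor
  map_src := by simp [prod]
  map_tgt := by simp [prod]
  map_ident := by simp [prod]
  map_comp := by simp [prod, prodComp, compose]

/-- The pairing of two internal functors. -/
@[simps] noncomputable def prodLift {K A B : InternalCat V} (H : InternalFunctor K A)
    (L : InternalFunctor K B) : InternalFunctor K (A.prod B) where
  onOb := lift H.onOb L.onOb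
  onMor := lift H.onMor L.onMor
  map_src := by simp [prod, H.map_src, L.map_src]
  map_tgt := by simp [prod, H.map_tgt, L.map_tgt]
  map_ident := by simp [prod, H.map_ident, L.map_ident]
  map_comp := by
    refine Eq.trans ?_ (lift_prodComp A B _ _ _).symm
    refine (comp_lift _ _ _).trans ?_
    rw [H.map_comp, L.map_comp]
    have h₁ {Z : V} (z : Z ⟶ K.mor) : z ≫ H.onMor = (z ≫ lift H.onMor L.onMor) ≫ fst _ _ := by simp
    have h₂ {Z : V} (z : Z ⟶ K.mor) : z ≫ L.onMor = (z ≫ lift H.onMor L.onMor) ≫ snd _ _ := by simp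
    exact congrArg₂ lift (compose_congr (h₁ _) (h₁ _) _) (compose_congr (h₂ _) (h₂ _) _)

/-- The unique internal functor to the constant internal category at the terminal object. -/
noncomputable def toCstUnit (A : InternalCat V) : InternalFunctor A (cst (𝟙_ V)) where
  onOb := toUnit _
  onMor := toUnit _
  map_src := toUnit_unique _ _
  map_tgt := toUnit_unique _ _
  map_ident := toUnit_unique _ _
  map_comp := toUnit_unique _ _

/-- `Cat(V)` has finite products: the terminal object is the constant internal category at the
terminal object of `V`, and binary products are formed levelwise. -/
noncomputable instance : CartesianMonoidalCategory (InternalCat V) :=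
  .ofChosenFiniteProducts
    ⟨asEmptyCone (cst (𝟙_ V)), IsTerminal.ofUniqueHom (fun A => A.toCstUnit)
      (fun _ _ => hom_ext (toUnit_unique _ _) (toUnit_unique _ _))⟩
    (fun A B => ⟨BinaryFan.mk (P := A.prod B) (prodFst A B) (prodSnd A B),
      BinaryFan.IsLimit.mk _ (fun H L => prodLift H L)
        (fun _ _ => hom_ext (lift_fst _ _) (lift_fst _ _))
        (fun _ _ => hom_ext (lift_snd _ _) (lift_snd _ _))
        (fun H L _ h₁ h₂ => hom_ext
          (CartesianMonoidalCategory.hom_ext _ _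
            ((congrArg InternalFunctor.onOb h₁).trans (lift_fst H.onOb L.onOb).symm)
            ((congrArg InternalFunctor.onOb h₂).trans (lift_snd H.onOb L.onOb).symm))
          (CartesianMonoidalCategory.hom_ext _ _
            ((congrArg InternalFunctor.onMor h₁).trans (lift_fst H.onMor L.onMor).symm)
            ((congrArg InternalFunctor.onMor h₂).trans (lift_snd H.onMor L.onMor).symm)))⟩)

theorem tensorObj_eq (A B : InternalCat V) : A ⊗ B = A.prod B := rfl

theorem tensorUnit_eq : 𝟙_ (InternalCat V) = cst (𝟙_ V) := rfl

theorem fst_eq (A B : InternalCat V) : fst A B = prodFst A B := rfl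

theorem snd_eq (A B : InternalCat V) : snd A B = prodSnd A B := rfl

theorem lift_eq {K A B : InternalCat V} (H : K ⟶ A) (L : K ⟶ B) : lift H L = prodLift H L := by
  ext
  · rw [lift_fst]; exact hom_ext (lift_fst _ _).symm (lift_fst _ _).symm
  · rw [lift_snd]; exact hom_ext (lift_snd _ _).symm (lift_snd _ _).symm

theorem whiskerLeft_eq (A : InternalCat V) {B B' : InternalCat V} (H : B ⟶ B') :
    A ◁ H = prodLift (prodFst A B) (InternalFunctor.comp (prodSnd A B) H) := by
  have : A ◁ H = lift (fst A B) (snd A B ≫ H) := by ext <;> simp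
  rw [this, lift_eq]; rfl

theorem whiskerLeft_onOb (A : InternalCat V) {B B' : InternalCat V} (H : B ⟶ B') :
    (A ◁ H).onOb = A.ob ◁ H.onOb := by
  have : lift (fst A.ob B.ob) (snd A.ob B.ob ≫ H.onOb) = A.ob ◁ H.onOb := by ext <;> simp
  rw [whiskerLeft_eq]
  exact this

theorem whiskerLeft_onMor (A : InternalCat V) {B B' : InternalCat V} (H : B ⟶ B') :
    (A ◁ H).onMor = A.mor ◁ H.onMor := by
  have : lift (fst A.mor B.mor) (snd A.mor B.mor ≫ H.onMor) = A.mor ◁ H.onMor := by ext <;> simp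
  rw [whiskerLeft_eq]
  exact this

end InternalCat
end Cartesian

section Closed

attribute [local simp] pullback.lift_fst pullback.lift_snd pullback.lift_fst_assoc
  pullback.lift_snd_assoc

variable {V : Type u} [Category.{v} V] [HasPullbacks V] [CartesianMonoidalCategory V]
  [MonoidalClosed V]

namespace InternalCat

theorem uncurry_comp_ihom_map {X Y Z W : V} (f : W ⟶ (ihom X).obj Y) (g : Y ⟶ Z) :
    MonoidalClosed.uncurry (f ≫ (ihom X).map g) = MonoidalClosed.uncurry f ≫ g :=
  MonoidalClosed.uncurry_natural_right f g

theorem powComp_aux (X : V) (A : InternalCat V) {W : V} {f g : W ⟶ (ihom X).obj A.mor}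
    (h : f ≫ (ihom X).map A.tgt = g ≫ (ihom X).map A.src) :
    MonoidalClosed.uncurry f ≫ A.tgt = MonoidalClosed.uncurry g ≫ A.src := by
  rw [← uncurry_comp_ihom_map, h, uncurry_comp_ihom_map]

/-- The composition map of the internal category `[X, A]`. -/
noncomputable def powComp (X : V) (A : InternalCat V) :
    pullback ((ihom X).map A.tgt) ((ihom X).map A.src) ⟶ (ihom X).obj A.mor :=
  MonoidalClosed.curry (A.compose
    (MonoidalClosed.uncurry (pullback.fst ((ihom X).map A.tgt) ((ihom X).map A.src)))
    (MonoidalClosed.uncurry (pullback.snd ((ihom X).map A.tgt) ((ihom X).map A.src)))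
    (powComp_aux X A pullback.condition))

theorem lift_powComp (X : V) (A : InternalCat V) {W : V} (f g : W ⟶ (ihom X).obj A.mor)
    (h : f ≫ (ihom X).map A.tgt = g ≫ (ihom X).map A.src) :
    pullback.lift f g h ≫ powComp X A = MonoidalClosed.curry
      (A.compose (MonoidalClosed.uncurry f) (MonoidalClosed.uncurry g) (powComp_aux X A h)) := by
  rw [powComp, ← MonoidalClosed.curry_natural_left, comp_compose]
  congr 1
  refine compose_congr ?_ ?_ _ <;> rw [← MonoidalClosed.uncurry_natural_left] <;> simp

/-- The internal category `[X, A]` with objects `[X, A₀]` and morphisms `[X, A₁]`. -/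
noncomputable def pow (X : V) (A : InternalCat V) : InternalCat V where
  ob := (ihom X).obj A.ob
  mor := (ihom X).obj A.mor
  src := (ihom X).map A.src
  tgt := (ihom X).map A.tgt
  comp := powComp X A
  ident := (ihom X).map A.ident
  ident_src := by rw [← CategoryTheory.Functor.map_comp, A.ident_src, CategoryTheory.Functor.map_id]
  ident_tgt := by rw [← CategoryTheory.Functor.map_comp, A.ident_tgt, CategoryTheory.Functor.map_id]
  comp_src := by
    apply MonoidalClosed.uncurry_injective
    rw [uncurry_comp_ihom_map, powComp, MonoidalClosed.uncurry_curry, compose_src,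
      uncurry_comp_ihom_map]
  comp_tgt := by
    apply MonoidalClosed.uncurry_injective
    rw [uncurry_comp_ihom_map, powComp, MonoidalClosed.uncurry_curry, compose_tgt,
      uncurry_comp_ihom_map]
  ident_comp := by
    rw [lift_powComp]
    apply MonoidalClosed.uncurry_injective
    rw [MonoidalClosed.uncurry_curry]
    refine (compose_congr ?_ rfl _).trans (A.ident_compose _)
    rw [← CategoryTheory.Functor.map_comp, ← uncurry_comp_ihom_map, Category.id_comp]
  comp_ident := by
    rw [lift_powComp]
    apply MonoidalClosed.uncurry_injective
    rw [MonoidalClosed.uncurry_curry]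
    refine (compose_congr rfl ?_ _).trans (A.compose_ident _)
    rw [← CategoryTheory.Functor.map_comp, ← uncurry_comp_ihom_map, Category.id_comp]
  assoc := by
    refine assoc_of_forall (fun W f g k h h' h₁ h₂ => ?_) rfl rfl _ _
    simp only [lift_powComp, MonoidalClosed.uncurry_curry]
    exact congrArg _ (compose_assoc _ _ _ _ _)

theorem cst_compose {X W : V} (f g : W ⟶ X) (h : f ≫ (cst X).tgt = g ≫ (cst X).src) :
    (cst X).compose f g h = f := pullback.lift_fst _ _ _

/-- Currying an internal functor `cst X × K ⟶ A`, on objects and on morphisms. -/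
noncomputable def powCurry {X : V} {K A : InternalCat V} (H : InternalFunctor (prod (cst X) K) A) :
    InternalFunctor K (pow X A) where
  onOb := MonoidalClosed.curry (A := X) (Y := K.ob) H.onOb
  onMor := MonoidalClosed.curry (A := X) (Y := K.mor) H.onMor
  map_src := by
    have h : H.onMor ≫ A.src = (X ◁ K.src) ≫ H.onOb := by
      rw [H.map_src, ← id_tensorHom]; rfl
    exact (MonoidalClosed.curry_natural_right _ _).symm.trans
      ((congrArg _ h).trans (MonoidalClosed.curry_natural_left _ _))
  map_tgt := by
    have h : H.onMor ≫ A.tgt = (X ◁ K.tgt) ≫ H.onOb := by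
      rw [H.map_tgt, ← id_tensorHom]; rfl
    exact (MonoidalClosed.curry_natural_right _ _).symm.trans
      ((congrArg _ h).trans (MonoidalClosed.curry_natural_left _ _))
  map_ident := by
    have h : H.onOb ≫ A.ident = (X ◁ K.ident) ≫ H.onMor := by
      rw [← H.map_ident, ← id_tensorHom]; rfl
    exact ((MonoidalClosed.curry_natural_right _ _).symm.trans
      ((congrArg _ h).trans (MonoidalClosed.curry_natural_left _ _))).symm
  map_comp := by
    refine Eq.trans ?_ (lift_powComp X A _ _ _).symm
    refine (MonoidalClosed.curry_natural_left _ _).symm.trans (congrArg _ ?_)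
    have h : (X ◁ pullback.fst K.tgt K.src) ≫ (𝟙 X ⊗ₘ K.tgt) =
        (X ◁ pullback.snd K.tgt K.src) ≫ (𝟙 X ⊗ₘ K.src) := by
      simp only [id_tensorHom, ← MonoidalCategory.whiskerLeft_comp, pullback.condition]
    have e : X ◁ K.comp = (prod (cst X) K).compose (X ◁ pullback.fst K.tgt K.src)
        (X ◁ pullback.snd K.tgt K.src) h := by
      refine Eq.trans ?_ (lift_prodComp (cst X) K _ _ h).symm
      refine CartesianMonoidalCategory.hom_ext _ _ ?_ ?_
      · exact (whiskerLeft_fst X K.comp).trans (((cst_compose _ _ _).trans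
          (whiskerLeft_fst X _)).symm.trans (lift_fst _ _).symm)
      · refine Eq.trans ?_ (lift_snd _ _).symm
        refine (whiskerLeft_snd X K.comp).trans ?_
        rw [comp_eq_compose, comp_compose]
        exact compose_congr (whiskerLeft_snd X _).symm (whiskerLeft_snd X _).symm _
    refine (congrArg (· ≫ H.onMor) e).trans ((H.compose_onMor _ _ h).trans ?_)
    refine compose_congr ?_ ?_ _ <;>
      exact ((MonoidalClosed.uncurry_natural_left _ _).trans
        (congrArg _ (MonoidalClosed.uncurry_curry _))).symm

/-- Uncurrying an internal functor `K ⟶ [X, A]`, on objects and on morphisms. -/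
noncomputable def powUncurry {X : V} {K A : InternalCat V} (H : InternalFunctor K (pow X A)) :
    InternalFunctor (prod (cst X) K) A where
  onOb := MonoidalClosed.uncurry (A := X) (Y := K.ob) H.onOb
  onMor := MonoidalClosed.uncurry (A := X) (Y := K.mor) H.onMor
  map_src := (MonoidalClosed.uncurry_natural_right (A := X) (X := K.mor) (Y := A.mor) H.onMor A.src).symm.trans
    ((congrArg (MonoidalClosed.uncurry (A := X)) H.map_src).trans
      ((MonoidalClosed.uncurry_natural_left (A := X) K.src H.onOb).trans
        (congrArg (· ≫ MonoidalClosed.uncurry (A := X) (Y := K.ob) H.onOb)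
          (id_tensorHom X K.src).symm)))
  map_tgt := (MonoidalClosed.uncurry_natural_right (A := X) (X := K.mor) (Y := A.mor) H.onMor A.tgt).symm.trans
    ((congrArg (MonoidalClosed.uncurry (A := X)) H.map_tgt).trans
      ((MonoidalClosed.uncurry_natural_left (A := X) K.tgt H.onOb).trans
        (congrArg (· ≫ MonoidalClosed.uncurry (A := X) (Y := K.ob) H.onOb)
          (id_tensorHom X K.tgt).symm)))
  map_ident := ((MonoidalClosed.uncurry_natural_right (A := X) (X := K.ob) (Y := A.ob) H.onOb
    A.ident).symm.trans ((congrArg (MonoidalClosed.uncurry (A := X)) H.map_ident.symm).trans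
      ((MonoidalClosed.uncurry_natural_left (A := X) K.ident H.onMor).trans
        (congrArg (· ≫ MonoidalClosed.uncurry (A := X) (Y := K.mor) H.onMor)
          (id_tensorHom X K.ident).symm)))).symm
  map_comp := by
    have key : ∀ (W : V) (x : W ⟶ X) (f g : W ⟶ K.mor) (h : f ≫ K.tgt = g ≫ K.src)
        (h' : (lift x f ≫ MonoidalClosed.uncurry (A := X) (Y := K.mor) H.onMor) ≫ A.tgt =
          (lift x g ≫ MonoidalClosed.uncurry (A := X) (Y := K.mor) H.onMor) ≫ A.src),
        lift x (K.compose f g h) ≫ MonoidalClosed.uncurry (A := X) (Y := K.mor) H.onMor =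
          A.compose (lift x f ≫ MonoidalClosed.uncurry (A := X) (Y := K.mor) H.onMor)
            (lift x g ≫ MonoidalClosed.uncurry (A := X) (Y := K.mor) H.onMor) h' := by
      intro W x f g h h'
      have e (k : W ⟶ K.mor) : lift x k ≫ MonoidalClosed.uncurry (A := X) (Y := K.mor) H.onMor =
          lift x (𝟙 W) ≫ MonoidalClosed.uncurry (A := X) (k ≫ H.onMor) := by
        refine Eq.trans ?_ (congrArg (lift x (𝟙 W) ≫ ·)
          (MonoidalClosed.uncurry_natural_left (A := X) k H.onMor).symm)
        rw [← Category.assoc]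
        congr 1
        ext <;> simp
      have c := (H.compose_onMor f g h).trans (lift_powComp X A _ _ _)
      rw [e]
      refine (congrArg (fun t => lift x (𝟙 W) ≫ MonoidalClosed.uncurry (A := X) t) c).trans ?_
      rw [MonoidalClosed.uncurry_curry, comp_compose]
      exact compose_congr (e f).symm (e g).symm _
    let P : _ ⟶ X ⊗ K.mor := pullback.fst (prod (cst X) K).tgt (prod (cst X) K).src
    let Q : _ ⟶ X ⊗ K.mor := pullback.snd (prod (cst X) K).tgt (prod (cst X) K).src
    have c : P ≫ (𝟙 X ⊗ₘ K.tgt) = Q ≫ (𝟙 X ⊗ₘ K.src) := pullback.condition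
    have c₁ : P ≫ fst X K.mor = Q ≫ fst X K.mor := by simpa using c =≫ fst _ _
    have c₂ : (P ≫ snd X K.mor) ≫ K.tgt = (Q ≫ snd X K.mor) ≫ K.src := by
      simpa using c =≫ snd _ _
    have h₀ : (prod (cst X) K).comp = lift (P ≫ fst X K.mor) (K.compose _ _ c₂) :=
      congrArg (fun t => lift (X := X) t (K.compose _ _ c₂)) (cst_compose _ _ _)
    have hP : lift (P ≫ fst X K.mor) (P ≫ snd X K.mor) = P := by ext <;> simp
    have hQ : lift (P ≫ fst X K.mor) (Q ≫ snd X K.mor) = Q := by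
      rw [c₁]; ext <;> simp
    have hs : (MonoidalClosed.uncurry (A := X) (Y := K.mor) H.onMor) ≫ A.src =
        (𝟙 X ⊗ₘ K.src) ≫ MonoidalClosed.uncurry (A := X) (Y := K.ob) H.onOb :=
      (MonoidalClosed.uncurry_natural_right (A := X) (X := K.mor) (Y := A.mor) H.onMor A.src).symm.trans
        ((congrArg (MonoidalClosed.uncurry (A := X)) H.map_src).trans
          ((MonoidalClosed.uncurry_natural_left (A := X) K.src H.onOb).trans
            (congrArg (· ≫ MonoidalClosed.uncurry (A := X) (Y := K.ob) H.onOb)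
              (id_tensorHom X K.src).symm)))
    have ht : (MonoidalClosed.uncurry (A := X) (Y := K.mor) H.onMor) ≫ A.tgt =
        (𝟙 X ⊗ₘ K.tgt) ≫ MonoidalClosed.uncurry (A := X) (Y := K.ob) H.onOb :=
      (MonoidalClosed.uncurry_natural_right (A := X) (X := K.mor) (Y := A.mor) H.onMor A.tgt).symm.trans
        ((congrArg (MonoidalClosed.uncurry (A := X)) H.map_tgt).trans
          ((MonoidalClosed.uncurry_natural_left (A := X) K.tgt H.onOb).trans
            (congrArg (· ≫ MonoidalClosed.uncurry (A := X) (Y := K.ob) H.onOb)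
              (id_tensorHom X K.tgt).symm)))
    refine (congrArg (· ≫ MonoidalClosed.uncurry (A := X) (Y := K.mor) H.onMor) h₀).trans ?_
    refine (key _ (P ≫ fst X K.mor) (P ≫ snd X K.mor) (Q ≫ snd X K.mor) c₂ ?_).trans ?_
    · rw [hP, hQ, Category.assoc, Category.assoc, hs, ht, reassoc_of% c]
    · refine (compose_congr ?_ ?_ _)
      · rw [hP]; rfl
      · rw [hQ]; rfl

/-- Internal functors `cst X × K ⟶ A` correspond to internal functors `K ⟶ [X, A]`. -/
noncomputable def powEquiv (X : V) (K A : InternalCat V) : (cst X ⊗ K ⟶ A) ≃ (K ⟶ pow X A) where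
  toFun := powCurry
  invFun := powUncurry
  left_inv H := hom_ext
    (MonoidalClosed.uncurry_curry (A := X) (X := K.ob) (Y := A.ob) H.onOb)
    (MonoidalClosed.uncurry_curry (A := X) (X := K.mor) (Y := A.mor) H.onMor)
  right_inv H := hom_ext
    (MonoidalClosed.curry_uncurry (A := X) (X := K.ob) (Y := A.ob) H.onOb)
    (MonoidalClosed.curry_uncurry (A := X) (X := K.mor) (Y := A.mor) H.onMor)

theorem powEquiv_natural (X : V) {K' K A : InternalCat V} (f : K' ⟶ K) (g : cst X ⊗ K ⟶ A) :
    powEquiv X K' A (cst X ◁ f ≫ g) = f ≫ powEquiv X K A g := by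
  refine hom_ext ?_ ?_
  · refine Eq.trans ?_ (MonoidalClosed.curry_natural_left (A := X) f.onOb g.onOb)
    exact congrArg (fun t => MonoidalClosed.curry (A := X) (Y := K'.ob) (t ≫ g.onOb))
      (whiskerLeft_onOb (cst X) f)
  · refine Eq.trans ?_ (MonoidalClosed.curry_natural_left (A := X) f.onMor g.onMor)
    exact congrArg (fun t => MonoidalClosed.curry (A := X) (Y := K'.mor) (t ≫ g.onMor))
      (whiskerLeft_onMor (cst X) f)

/-- The constant internal category at an object `X` is exponentiable in `Cat(V)`: the internal
hom out of it sends `A` to `[X, A]`. -/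
noncomputable instance (X : V) : Closed (cst X) where
  rightAdj := Adjunction.rightAdjointOfEquiv (F := tensorLeft (cst X)) (G_obj := pow X)
    (fun K A => powEquiv X K A) (fun _ _ _ f g => powEquiv_natural X f g)
  adj := Adjunction.adjunctionOfEquivRight (F := tensorLeft (cst X)) (fun K A => powEquiv X K A)
    (fun _ _ _ f g => powEquiv_natural X f g)

/-- The internal hom `⟦cst X, A⟧` is `[X, A]`. -/
theorem ihom_cst_obj (X : V) (A : InternalCat V) : (ihom (cst X)).obj A = pow X A := rfl

/-- Currying in `Cat(V)` out of a constant internal category is currying in `V` on objects and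
on morphisms. -/
theorem curry_eq_powEquiv (X : V) {K A : InternalCat V} (H : cst X ⊗ K ⟶ A) :
    MonoidalClosed.curry H = powEquiv X K A H :=
  congrFun (congrArg DFunLike.coe (congrFun (congrFun (Adjunction.mkOfHomEquiv_homEquiv
    (F := tensorLeft (cst X)) (G := Adjunction.rightAdjointOfEquiv (F := tensorLeft (cst X))
      (G_obj := pow X) (fun K A => powEquiv X K A)
      (fun _ _ _ f g => powEquiv_natural X f g)) _) K) A)) H

/-- The internal functor `A ⟶ ⟦cst X, A⟧` precomposing with `cst X ⟶ 1`. -/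
noncomputable def diag (X : V) (A : InternalCat V) : A ⟶ (ihom (cst X)).obj A :=
  MonoidalClosed.curry (snd (cst X) A)

end InternalCat
end Closed

section Underlying

attribute [local simp] pullback.lift_fst pullback.lift_snd pullback.lift_fst_assoc
  pullback.lift_snd_assoc

variable {V : Type u} [Category.{v} V] [HasPullbacks V] [CartesianMonoidalCategory V]

/-- The objects of the `V`-category underlying an internal category `A` are the global elements
of the object of objects of `A`. -/
structure Und (A : InternalCat V) where
  /-- the global element -/
  elt : 𝟙_ V ⟶ A.ob

namespace Und

variable {A : InternalCat V}

/-- The hom-object from `a` to `b` is the pullback of `(s, t) : A₁ ⟶ A₀ × A₀` along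
`(a, b) : 1 ⟶ A₀ × A₀`. -/
noncomputable def hom (a b : Und A) : V := pullback (lift A.src A.tgt) (lift a.elt b.elt)

/-- The canonical map from a hom-object to the object of morphisms. -/
noncomputable def π (a b : Und A) : hom a b ⟶ A.mor :=
  pullback.fst (lift A.src A.tgt) (lift a.elt b.elt)

theorem π_condition (a b : Und A) :
    π a b ≫ lift A.src A.tgt = toUnit _ ≫ lift a.elt b.elt := by
  refine (pullback.condition (f := lift A.src A.tgt) (g := lift a.elt b.elt)).trans ?_
  exact congrArg (· ≫ lift a.elt b.elt) (toUnit_unique _ _)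

theorem π_src (a b : Und A) : π a b ≫ A.src = toUnit _ ≫ a.elt := by
  simpa using π_condition a b =≫ fst _ _

theorem π_tgt (a b : Und A) : π a b ≫ A.tgt = toUnit _ ≫ b.elt := by
  simpa using π_condition a b =≫ snd _ _

theorem hom_ext {a b : Und A} {X : V} {f g : X ⟶ hom a b} (h : f ≫ π a b = g ≫ π a b) : f = g :=
  pullback.hom_ext h (toUnit_unique _ _)

/-- A map into a hom-object is a generalized morphism with the appropriate source and target. -/
noncomputable def mkHom {a b : Und A} {X : V} (f : X ⟶ A.mor) (hs : f ≫ A.src = toUnit _ ≫ a.elt)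
    (ht : f ≫ A.tgt = toUnit _ ≫ b.elt) : X ⟶ hom a b :=
  pullback.lift f (toUnit _) (by ext <;> simp [hs, ht])

@[simp] theorem mkHom_π {a b : Und A} {X : V} (f : X ⟶ A.mor)
    (hs : f ≫ A.src = toUnit _ ≫ a.elt) (ht : f ≫ A.tgt = toUnit _ ≫ b.elt) :
    mkHom f hs ht ≫ π a b = f := pullback.lift_fst _ _ _

/-- The identity of an object. -/
noncomputable def id (a : Und A) : 𝟙_ V ⟶ hom a a :=
  mkHom (a.elt ≫ A.ident)
    (by simp [toUnit_unique (toUnit (𝟙_ V)) (𝟙 _)])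
    (by simp [toUnit_unique (toUnit (𝟙_ V)) (𝟙 _)])

/-- Composition of morphisms. -/
noncomputable def comp (a b c : Und A) : hom a b ⊗ hom b c ⟶ hom a c :=
  mkHom (A.compose (fst _ _ ≫ π a b) (snd _ _ ≫ π b c) (by simp [π_src, π_tgt]))
    (by simp [InternalCat.compose_src, π_src])
    (by simp [InternalCat.compose_tgt, π_tgt])

theorem comp_π (a b c : Und A) : comp a b c ≫ π a c =
    A.compose (fst _ _ ≫ π a b) (snd _ _ ≫ π b c) (by simp [π_src, π_tgt]) := mkHom_π _ _ _

/-- The `V`-category underlying an internal category. -/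
noncomputable instance : EnrichedCategory V (Und A) where
  Hom := hom
  id := id
  comp := comp
  id_comp a b := by
    refine hom_ext ?_
    simp only [Category.assoc, comp_π, InternalCat.comp_compose, Category.id_comp]
    refine (InternalCat.compose_congr ?_ ?_ _).trans (InternalCat.ident_compose (π a b))
    · simp only [← Category.assoc, π_src]
      simp [id]
    · simp
  comp_id a b := by
    refine hom_ext ?_
    simp only [Category.assoc, comp_π, InternalCat.comp_compose, Category.id_comp]
    refine (InternalCat.compose_congr ?_ ?_ _).trans (InternalCat.compose_ident (π a b))
    · simp
    · simp only [← Category.assoc, π_tgt]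
      simp [id]
  assoc a b c d := by
    refine hom_ext ?_
    have h₁ : fst (hom a b) (hom b c ⊗ hom c d) ≫ π a b ≫ A.tgt =
        snd _ _ ≫ fst _ _ ≫ π b c ≫ A.src := by simp [π_src, π_tgt]
    have h₂ : snd (hom a b) (hom b c ⊗ hom c d) ≫ fst _ _ ≫ π b c ≫ A.tgt =
        snd _ _ ≫ snd _ _ ≫ π c d ≫ A.src := by simp [π_src, π_tgt]
    simp only [Category.assoc, comp_π, InternalCat.comp_compose]
    refine (InternalCat.compose_congr ?_ ?_ _).trans
      ((InternalCat.compose_assoc (fst _ _ ≫ π a b) (snd _ _ ≫ fst _ _ ≫ π b c)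
      (snd _ _ ≫ snd _ _ ≫ π c d) (by simpa using h₁) (by simpa using h₂)).trans
        (InternalCat.compose_congr ?_ ?_ _))
    · simp only [whiskerRight_fst_assoc, comp_π, InternalCat.comp_compose]
      exact InternalCat.compose_congr (by simp) (by simp) _
    · simp
    · simp
    · simp only [whiskerLeft_snd_assoc, comp_π, InternalCat.comp_compose]

end Und

/-- An object `T` of a `V`-category is `V`-terminal if the unique map from each hom-object
into `T` to the terminal object is an isomorphism. -/
def IsVTerminal {E : Type w} [EnrichedCategory V E] (T : E) : Prop :=
  ∀ a : E, IsIso (toUnit (a ⟶[V] T))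

/-- A conservative family of objects: a map is an isomorphism if and only if composing with it
is bijective on generalized elements defined over the members of the family. -/
def IsConservativeFamily (G : Set V) : Prop :=
  ∀ ⦃Y Z : V⦄ (f : Y ⟶ Z), IsIso f ↔ ∀ X ∈ G, Function.Bijective fun g : X ⟶ Y => g ≫ f

end Underlying

section Enriched

variable {V : Type u} [Category.{v} V] [CartesianMonoidalCategory V]

section

variable {D : Type w'} [EnrichedCategory V D]

/-- The composite of two generalized elements of hom-objects of a `V`-category. -/
def eCompose {W : V} {a b c : D} (f : W ⟶ (a ⟶[V] b)) (g : W ⟶ (b ⟶[V] c)) : W ⟶ (a ⟶[V] c) :=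
  lift f g ≫ eComp V a b c

theorem comp_eCompose {W W' : V} (z : W' ⟶ W) {a b c : D} (f : W ⟶ (a ⟶[V] b))
    (g : W ⟶ (b ⟶[V] c)) : z ≫ eCompose f g = eCompose (z ≫ f) (z ≫ g) := by
  rw [eCompose, comp_lift_assoc, eCompose]

theorem id_eCompose {W : V} {a b : D} (f : W ⟶ (a ⟶[V] b)) :
    eCompose (toUnit W ≫ eId V a) f = f := by
  have := congrArg (f ≫ ·) (e_id_comp V a b)
  simp only [← Category.assoc, Category.comp_id] at this
  refine Eq.trans (congrArg (· ≫ eComp V a a b) ?_) this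
  ext
  · simp
  · simp

theorem eCompose_id {W : V} {a b : D} (f : W ⟶ (a ⟶[V] b)) :
    eCompose f (toUnit W ≫ eId V b) = f := by
  have := congrArg (f ≫ ·) (e_comp_id V a b)
  simp only [← Category.assoc, Category.comp_id] at this
  refine Eq.trans (congrArg (· ≫ eComp V a b b) ?_) this
  ext
  · simp
  · simp

theorem eCompose_assoc {W : V} {a b c d : D} (f : W ⟶ (a ⟶[V] b)) (g : W ⟶ (b ⟶[V] c))
    (h : W ⟶ (c ⟶[V] d)) : eCompose (eCompose f g) h = eCompose f (eCompose g h) := by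
  have := congrArg (lift f (lift g h) ≫ ·) (e_assoc V a b c d)
  simp only [← Category.assoc] at this
  refine Eq.trans (congrArg (· ≫ eComp V a c d) ?_)
    (this.trans (congrArg (· ≫ eComp V a b d) ?_))
  · ext <;> simp [eCompose]
  · ext <;> simp [eCompose]

variable {C : Type w} [EnrichedCategory V C]

theorem map_eCompose (F : EnrichedFunctor V C D) {W : V} {a b c : C} (f : W ⟶ (a ⟶[V] b))
    (g : W ⟶ (b ⟶[V] c)) :
    eCompose f g ≫ F.map a c = eCompose (f ≫ F.map a b) (g ≫ F.map b c) := by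
  rw [eCompose, Category.assoc, F.map_comp, eCompose, ← Category.assoc, lift_map]

/-- A `V`-natural transformation between `V`-functors: a family of global elements
`1 ⟶ D(F a, G a)` such that the two induced maps `C(a, b) ⟶ D(F a, G b)` agree. -/
@[ext]
structure VNatTrans (F G : EnrichedFunctor V C D) where
  /-- the component at an object -/
  app (a : C) : 𝟙_ V ⟶ (F.obj a ⟶[V] G.obj a)
  naturality (a b : C) : eCompose (F.map a b) (toUnit _ ≫ app b) =
    eCompose (toUnit _ ≫ app a) (G.map a b)

namespace VNatTrans

/-- The identity `V`-natural transformation. -/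
@[simps] def id (F : EnrichedFunctor V C D) : VNatTrans F F where
  app a := eId V (F.obj a)
  naturality a b := by rw [eCompose_id, id_eCompose]

/-- The composite of `V`-natural transformations. -/
@[simps] def comp {F G H : EnrichedFunctor V C D} (α : VNatTrans F G) (β : VNatTrans G H) :
    VNatTrans F H where
  app a := eCompose (α.app a) (β.app a)
  naturality a b := by
    rw [comp_eCompose, comp_eCompose, ← eCompose_assoc, α.naturality, eCompose_assoc,
      β.naturality, eCompose_assoc]

/-- A `V`-natural isomorphism is a `V`-natural transformation with a two-sided inverse. -/
def IsVNatIso {F G : EnrichedFunctor V C D} (α : VNatTrans F G) : Prop :=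
  ∃ β : VNatTrans G F, α.comp β = id F ∧ β.comp α = id G

end VNatTrans

end

section Presheaf

variable [MonoidalClosed V]

/-- A generalized element of an internal hom may be evaluated at generalized elements. -/
theorem lift_uncurry {W W' X Y : V} (y : W ⟶ X) (w : W ⟶ W') (f : W' ⟶ (ihom X).obj Y) :
    lift y w ≫ MonoidalClosed.uncurry f = lift y (𝟙 W) ≫ MonoidalClosed.uncurry (w ≫ f) := by
  rw [MonoidalClosed.uncurry_natural_left, ← Category.assoc, lift_whiskerLeft, Category.id_comp]

theorem uncurry_toUnit_comp {W X Y : V} (f : 𝟙_ V ⟶ (ihom X).obj Y) :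
    MonoidalClosed.uncurry (toUnit W ≫ f) = fst X W ≫ MonoidalClosed.uncurry' f := by
  rw [MonoidalClosed.uncurry_natural_left, MonoidalClosed.uncurry', ← Category.assoc]
  congr 1
  ext
  simp

theorem uncurry_eCompose_aux {W X Y Z H K : V} (e : X ⊗ H ⟶ Y) (e' : Y ⊗ K ⟶ Z) (f : W ⟶ H)
    (g : W ⟶ K) : X ◁ lift f g ≫ (α_ X H K).inv ≫ e ▷ K ≫ e' =
      lift (X ◁ f ≫ e) (snd X W) ≫ Y ◁ g ≫ e' := by
  simp only [← Category.assoc]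
  congr 1
  ext
  · simp only [Category.assoc, whiskerRight_fst, whiskerLeft_fst, lift_fst]
    simp only [← Category.assoc]
    congr 1
    ext <;> simp
  · simp

/-- Composition in the self-enrichment of `V` is composition of maps. -/
theorem uncurry_eCompose {W X Y Z : V} (f : W ⟶ EnrichedCategory.Hom X Y)
    (g : W ⟶ EnrichedCategory.Hom Y Z) :
    MonoidalClosed.uncurry (A := X) (Y := W) (eCompose f g) =
      lift (MonoidalClosed.uncurry (A := X) (Y := W) f) (snd X W) ≫
        MonoidalClosed.uncurry (A := Y) (Y := W) g := by
  have e : MonoidalClosed.uncurry (A := X) (eComp V X Y Z) =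
      MonoidalClosed.compTranspose X Y Z := MonoidalClosed.uncurry_curry _
  refine (MonoidalClosed.uncurry_natural_left (A := X) (lift f g) (eComp V X Y Z)).trans ?_
  rw [e, MonoidalClosed.uncurry_eq (A := X) f, MonoidalClosed.uncurry_eq (A := Y) g]
  exact uncurry_eCompose_aux ((ihom.ev X).app Y) ((ihom.ev Y).app Z) f g

variable [BraidedCategory V] {C : Type w} [EnrichedCategory V C]

/-- The map `C(A, B) × F B ⟶ F A` corresponding to the action of a `V`-functor
`F : Cᵒᵖ ⥤ V` on hom-objects. -/
def evMap (F : EnrichedFunctor V Cᵒᵖ V) (A B : C) :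
    (EnrichedCategory.Hom A B : V) ⊗ F.obj (op B) ⟶ F.obj (op A) :=
  (β_ _ _).hom ≫ MonoidalClosed.uncurry (F.map (op B) (op A))

variable (F : EnrichedFunctor V Cᵒᵖ V)

theorem lift_evMap {W : V} {A B : C} (f : W ⟶ EnrichedCategory.Hom A B)
    (y : W ⟶ F.obj (op B)) :
    lift f y ≫ evMap F A B = lift y (𝟙 W) ≫ MonoidalClosed.uncurry (A := F.obj (op B)) (Y := W)
      (show W ⟶ (ihom _).obj _ from f ≫ F.map (op B) (op A)) := by
  rw [evMap, lift_braiding_hom_assoc]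
  exact lift_uncurry (W' := EnrichedCategory.Hom A B) y f (F.map (op B) (op A))

theorem eCompose_op {W : V} {A B D : C} (f : W ⟶ EnrichedCategory.Hom A B)
    (g : W ⟶ EnrichedCategory.Hom B D) :
    eCompose f g = eCompose (D := Cᵒᵖ) (a := op D) (b := op B) (c := op A) g f := by
  refine Eq.trans ?_ (congrArg (lift g f ≫ ·) (eComp_op_eq V (op A) (op B) (op D)).symm)
  exact (lift_braiding_hom_assoc _ _ _).symm

theorem eId_evMap {W : V} {A : C} (y : W ⟶ F.obj (op A)) :
    lift (toUnit _ ≫ eId V A) y ≫ evMap F A A = y := by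
  have h : toUnit W ≫ (eId V A ≫ F.map (op A) (op A)) =
      toUnit W ≫ MonoidalClosed.id (F.obj (op A)) := congrArg (toUnit W ≫ ·) (F.map_id (op A))
  have h' : MonoidalClosed.uncurry' (MonoidalClosed.id (F.obj (op A))) = 𝟙 _ := by
    rw [← MonoidalClosed.curry'_id, MonoidalClosed.uncurry'_curry']
  refine (lift_evMap F _ _).trans ?_
  rw [Category.assoc]
  refine (congrArg (lift y (𝟙 W) ≫ MonoidalClosed.uncurry (A := F.obj (op A)) ·) h).trans ?_
  rw [uncurry_toUnit_comp, h', Category.comp_id, lift_fst]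

theorem eCompose_evMap {W : V} {A B D : C} (f : W ⟶ EnrichedCategory.Hom A B)
    (g : W ⟶ EnrichedCategory.Hom B D) (y : W ⟶ F.obj (op D)) :
    lift (eCompose f g) y ≫ evMap F A D = lift f (lift g y ≫ evMap F B D) ≫ evMap F A B := by
  have h := (congrArg (· ≫ F.map (op D) (op A)) (eCompose_op f g)).trans
    (map_eCompose F (a := op D) (b := op B) (c := op A) g f)
  refine (lift_evMap F _ _).trans ?_
  refine (congrArg (lift y (𝟙 W) ≫ MonoidalClosed.uncurry (A := F.obj (op D)) ·) h).trans ?_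
  refine (congrArg (lift y (𝟙 W) ≫ ·) (uncurry_eCompose _ _)).trans ?_
  rw [lift_evMap, lift_evMap, ← Category.assoc, comp_lift, lift_snd]

theorem lift_eq_evMap {W : V} {A B : C} (f : W ⟶ EnrichedCategory.Hom A B)
    (y : W ⟶ F.obj (op B)) :
    lift y f ≫ MonoidalClosed.uncurry (A := F.obj (op B)) (X := F.obj (op A))
      (Y := EnrichedCategory.Hom A B) (F.map (op B) (op A)) = lift f y ≫ evMap F A B := by
  rw [evMap, lift_braiding_hom_assoc]

theorem lift_eComp_swap {W : V} {A B D : C} (f : W ⟶ EnrichedCategory.Hom A B)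
    (g : W ⟶ EnrichedCategory.Hom B D) :
    lift g f ≫ (β_ (EnrichedCategory.Hom B D) (EnrichedCategory.Hom A B)).hom ≫ eComp V A B D =
      eCompose f g := lift_braiding_hom_assoc _ _ _

theorem whiskerLeft_eq_lift {X Y Z : V} (f : Y ⟶ Z) : X ◁ f = lift (fst X Y) (snd X Y ≫ f) := by
  ext <;> simp

/-- The action of the representable presheaf on hom-objects. -/
def representableMap (c : C) (A B : C) :
    (EnrichedCategory.Hom B A : V) ⟶
      (ihom (EnrichedCategory.Hom A c : V)).obj (EnrichedCategory.Hom B c) :=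
  MonoidalClosed.curry
    ((β_ (EnrichedCategory.Hom A c : V) (EnrichedCategory.Hom B A)).hom ≫ eComp V B A c)

theorem uncurry_comp_representableMap (c : C) (A B : C) {W : V}
    (f : W ⟶ EnrichedCategory.Hom B A) :
    MonoidalClosed.uncurry (f ≫ representableMap c A B) = eCompose (snd _ _ ≫ f) (fst _ _) := by
  rw [MonoidalClosed.uncurry_natural_left, representableMap, MonoidalClosed.uncurry_curry,
    whiskerLeft_eq_lift, lift_eComp_swap]

/-- The representable `V`-functor `C(-, c)`. -/
def representable (c : C) : EnrichedFunctor V Cᵒᵖ V where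
  obj A := EnrichedCategory.Hom A.unop c
  map A B := representableMap c A.unop B.unop
  map_id A := by
    apply MonoidalClosed.uncurry_injective (A := EnrichedCategory.Hom A.unop c)
    refine (uncurry_comp_representableMap c A.unop A.unop (eId V A.unop)).trans ?_
    refine Eq.trans ?_ (MonoidalClosed.uncurry_curry _).symm
    rw [toUnit_unique (snd (EnrichedCategory.Hom A.unop c) (𝟙_ V)) (toUnit _), id_eCompose,
      rightUnitor_hom]
  map_comp A B D := by
    apply MonoidalClosed.uncurry_injective (A := EnrichedCategory.Hom A.unop c)
    refine (uncurry_comp_representableMap c A.unop D.unop (eComp V A B D)).trans ?_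
    have h : (representableMap c A.unop B.unop ⊗ₘ representableMap c B.unop D.unop) ≫
        eComp V (EnrichedCategory.Hom A.unop c : V) (EnrichedCategory.Hom B.unop c : V)
          (EnrichedCategory.Hom D.unop c : V) =
        eCompose (fst (EnrichedCategory.Hom B.unop A.unop) (EnrichedCategory.Hom D.unop B.unop) ≫
          representableMap c A.unop B.unop) (snd (EnrichedCategory.Hom B.unop A.unop)
            (EnrichedCategory.Hom D.unop B.unop) ≫ representableMap c B.unop D.unop) := by
      rw [eCompose]
      congr 1
      exact CartesianMonoidalCategory.hom_ext _ _
        ((tensorHom_fst _ _).trans (lift_fst _ _).symm)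
        ((tensorHom_snd _ _).trans (lift_snd _ _).symm)
    refine Eq.trans ?_ (congrArg (MonoidalClosed.uncurry
      (A := EnrichedCategory.Hom A.unop c)) h).symm
    refine Eq.trans ?_ (uncurry_eCompose _ _).symm
    refine Eq.trans ?_ (congrArg₂ (fun s t => lift s (snd _ _) ≫ t)
      (uncurry_comp_representableMap c A.unop B.unop (fst _ _))
      (uncurry_comp_representableMap c B.unop D.unop (snd _ _))).symm
    rw [comp_eCompose, lift_fst, lift_snd_assoc, ← eCompose_assoc]
    refine congrArg (eCompose · (fst _ _)) ?_
    refine (congrArg (snd _ _ ≫ ·) (eComp_op_eq V D B A)).trans ?_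
    rw [← comp_eCompose]
    exact congrArg (snd _ _ ≫ ·) (by rw [← lift_eComp_swap, lift_fst_snd, Category.id_comp])

variable {F}

theorem naturality_iff {F G : EnrichedFunctor V Cᵒᵖ V}
    (φ : ∀ A, 𝟙_ V ⟶ (ihom (F.obj A)).obj (G.obj A)) (A B : Cᵒᵖ) :
    (eCompose (F.map A B) (toUnit _ ≫ φ B) = eCompose (toUnit _ ≫ φ A) (G.map A B)) ↔
      evMap F B.unop A.unop ≫ MonoidalClosed.uncurry' (φ B) =
        EnrichedCategory.Hom B.unop A.unop ◁ MonoidalClosed.uncurry' (φ A) ≫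
          evMap G B.unop A.unop := by
  let H : V := EnrichedCategory.Hom B.unop A.unop
  have h₁ : (β_ H (F.obj A)).hom ≫ MonoidalClosed.uncurry (A := F.obj A) (Y := H)
      (eCompose (F.map A B) (toUnit _ ≫ φ B)) =
        evMap F B.unop A.unop ≫ MonoidalClosed.uncurry' (φ B) := by
    refine (congrArg ((β_ H (F.obj A)).hom ≫ ·) (uncurry_eCompose _ _)).trans ?_
    refine (congrArg (fun t => (β_ H (F.obj A)).hom ≫ lift _ _ ≫ t)
      (uncurry_toUnit_comp (φ B))).trans ?_
    rw [lift_fst_assoc, evMap, Category.assoc]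
  have h₂ : (β_ H (F.obj A)).hom ≫ MonoidalClosed.uncurry (A := F.obj A) (Y := H)
      (eCompose (toUnit _ ≫ φ A) (G.map A B)) =
        H ◁ MonoidalClosed.uncurry' (φ A) ≫ evMap G B.unop A.unop := by
    refine (congrArg ((β_ H (F.obj A)).hom ≫ ·) (uncurry_eCompose _ _)).trans ?_
    refine (congrArg (fun t => (β_ H (F.obj A)).hom ≫ lift t (snd _ _) ≫ _)
      (uncurry_toUnit_comp (φ A))).trans ?_
    rw [whiskerLeft_eq_lift]
    refine Eq.trans ?_ (lift_eq_evMap G _ _)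
    rw [← Category.assoc, comp_lift, braiding_hom_fst_assoc, braiding_hom_snd]
  rw [← h₁, ← h₂]
  constructor
  · intro h
    rw [h]
  · intro h
    exact MonoidalClosed.uncurry_injective (A := F.obj A)
      ((cancel_epi (β_ H (F.obj A)).hom).1 h)

/-- The map `F A ⟶ G A` corresponding to the component at `A` of a `V`-natural transformation
between `V`-functors `Cᵒᵖ ⥤ V`. -/
def VNatTrans.evApp {F G : EnrichedFunctor V Cᵒᵖ V} (α : VNatTrans F G) (A : C) :
    F.obj (op A) ⟶ G.obj (op A) :=
  MonoidalClosed.uncurry' (α.app (op A))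

variable (F)

theorem representable_evMap (c A B : C) : evMap (representable (V := V) c) A B = eComp V A B c := by
  have h : evMap (representable (V := V) c) A B =
      (β_ _ _).hom ≫ (β_ (EnrichedCategory.Hom B c : V) (EnrichedCategory.Hom A B)).hom ≫
        eComp V A B c := congrArg ((β_ _ _).hom ≫ ·) (MonoidalClosed.uncurry_curry _)
  rw [h, SymmetricCategory.symmetry_assoc]

theorem evMap_evApp {F G : EnrichedFunctor V Cᵒᵖ V} (α : VNatTrans F G) (A B : C) :
    evMap F A B ≫ α.evApp A = EnrichedCategory.Hom A B ◁ α.evApp B ≫ evMap G A B :=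
  (naturality_iff α.app (op B) (op A)).1 (α.naturality (op B) (op A))

/-- A `V`-natural transformation between `V`-functors `Cᵒᵖ ⥤ V` given by maps `F A ⟶ G A`. -/
def VNatTrans.ofEvApp {F G : EnrichedFunctor V Cᵒᵖ V}
    (φ : ∀ A : C, F.obj (op A) ⟶ G.obj (op A))
    (h : ∀ A B : C, evMap F A B ≫ φ A = EnrichedCategory.Hom A B ◁ φ B ≫ evMap G A B) :
    VNatTrans F G where
  app A := MonoidalClosed.curry' (X := F.obj A) (Y := G.obj A) (φ A.unop)
  naturality A B := by
    refine (naturality_iff (fun A => MonoidalClosed.curry' (X := F.obj A) (Y := G.obj A)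
      (φ A.unop)) A B).2 ?_
    rw [MonoidalClosed.uncurry'_curry', MonoidalClosed.uncurry'_curry']
    exact h B.unop A.unop

theorem VNatTrans.ofEvApp_evApp {F G : EnrichedFunctor V Cᵒᵖ V}
    (φ : ∀ A : C, F.obj (op A) ⟶ G.obj (op A))
    (h : ∀ A B : C, evMap F A B ≫ φ A = EnrichedCategory.Hom A B ◁ φ B ≫ evMap G A B) (A : C) :
    (VNatTrans.ofEvApp φ h).evApp A = φ A := MonoidalClosed.uncurry'_curry' _

theorem VNatTrans.ext_evApp {F G : EnrichedFunctor V Cᵒᵖ V} {α β : VNatTrans F G}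
    (h : ∀ A, α.evApp A = β.evApp A) : α = β :=
  VNatTrans.ext (funext fun A => MonoidalClosed.uncurry'_injective (h A.unop))

theorem eComp_yoneda (c : C) (x : 𝟙_ V ⟶ F.obj (op c)) (A B : C) :
    eComp V A B c ≫ lift (𝟙 (EnrichedCategory.Hom A c)) (toUnit _ ≫ x) ≫ evMap F A c =
      EnrichedCategory.Hom A B ◁
        (lift (𝟙 (EnrichedCategory.Hom B c)) (toUnit _ ≫ x) ≫ evMap F B c) ≫ evMap F A B := by
  have h : eComp V A B c = eCompose (fst (EnrichedCategory.Hom A B : V)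
      (EnrichedCategory.Hom B c)) (snd _ _) := by
    rw [eCompose, lift_fst_snd, Category.id_comp]
  rw [whiskerLeft_eq_lift, comp_lift_assoc, Category.comp_id, comp_toUnit_assoc, h,
    eCompose_evMap, comp_lift_assoc, Category.comp_id, comp_toUnit_assoc]

theorem eq_of_eComp (A c : C) (a : EnrichedCategory.Hom A c ⟶ F.obj (op A))
    (b : EnrichedCategory.Hom c c ⟶ F.obj (op c))
    (h : eComp V A c c ≫ a = EnrichedCategory.Hom A c ◁ b ≫ evMap F A c) :
    a = lift (𝟙 _) (toUnit _ ≫ eId V c ≫ b) ≫ evMap F A c := by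
  have := congrArg (lift (𝟙 (EnrichedCategory.Hom A c)) (toUnit _ ≫ eId V c) ≫ ·) h
  refine Eq.trans ?_ (this.trans ?_)
  · have e := eCompose_id (𝟙 (EnrichedCategory.Hom A c : V))
    rw [eCompose] at e
    exact (Category.id_comp _).symm.trans
      ((congrArg (· ≫ a) e.symm).trans (Category.assoc _ _ _))
  · rw [lift_whiskerLeft_assoc, Category.assoc]

/-- The `V`-natural transformation `C(-, c) ⇒ F` corresponding to an element `x` of `F c` under
the Yoneda correspondence; its component at `A` corresponds to the map
`C(A, c) ≅ C(A, c) × 1 ⟶ C(A, c) × F c ⟶ F A`. -/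
def yonedaTrans (c : C) (x : 𝟙_ V ⟶ F.obj (op c)) : VNatTrans (representable c) F :=
  VNatTrans.ofEvApp (F := representable c) (G := F)
    (fun A => lift (𝟙 (EnrichedCategory.Hom A c)) (toUnit _ ≫ x) ≫ evMap F A c) (fun A B => by
      rw [representable_evMap]
      exact eComp_yoneda F c x A B)

theorem yonedaTrans_evApp (c : C) (x : 𝟙_ V ⟶ F.obj (op c)) (A : C) :
    (yonedaTrans F c x).evApp A = lift (𝟙 _) (toUnit _ ≫ x) ≫ evMap F A c :=
  MonoidalClosed.uncurry'_curry' _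

/-- The transformation `yonedaTrans F c x` sends the identity of `c` to `x`. -/
theorem eId_yonedaTrans (c : C) (x : 𝟙_ V ⟶ F.obj (op c)) :
    eId V c ≫ (yonedaTrans F c x).evApp c = x := by
  have h₁ : toUnit (𝟙_ V) ≫ eId V c = eId V c := by
    rw [toUnit_unique (toUnit (𝟙_ V)) (𝟙 _), Category.id_comp]
  have h₂ : toUnit (𝟙_ V) ≫ x = x := by
    rw [toUnit_unique (toUnit (𝟙_ V)) (𝟙 _), Category.id_comp]
  refine (congrArg (eId V c ≫ ·) (yonedaTrans_evApp F c x c)).trans ?_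
  refine Eq.trans ?_ (eId_evMap F x)
  rw [← Category.assoc, comp_lift, Category.comp_id, comp_toUnit_assoc, h₁, h₂]

/-- The transformation `yonedaTrans F c x` is the only one that sends the identity of `c`
to `x`. -/
theorem eq_yonedaTrans (c : C) (x : 𝟙_ V ⟶ F.obj (op c)) (α : VNatTrans (representable c) F)
    (h : eId V c ≫ α.evApp c = x) : α = yonedaTrans F c x := by
  refine VNatTrans.ext_evApp fun A => ?_
  rw [yonedaTrans_evApp, ← h]
  have e := evMap_evApp α A c
  rw [representable_evMap] at e
  exact eq_of_eComp F A c _ _ e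

/-- The `V`-functor `F` is `V`-representable by `(c, x)` if the `V`-natural transformation
`C(-, c) ⇒ F` corresponding to `x` is a `V`-natural isomorphism. -/
def IsVRepresentableBy (c : C) (x : 𝟙_ V ⟶ F.obj (op c)) : Prop :=
  (yonedaTrans F c x).IsVNatIso

end Presheaf
end Enriched

section Elements

attribute [local simp] pullback.lift_fst pullback.lift_snd pullback.lift_fst_assoc
  pullback.lift_snd_assoc

variable {V : Type u} [Category.{v} V] [CartesianMonoidalCategory V] [BraidedCategory V]
  [MonoidalClosed V] [HasCoproducts.{w} V] {C : Type w} [EnrichedCategory V C]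
  (F : EnrichedFunctor V Cᵒᵖ V)

namespace Elements

/-- The summand `F A` of the object of objects. -/
abbrev obFam (A : C) : V := F.obj (op A)

/-- The summand `C(A, B) × F B` of the object of morphisms. -/
abbrev morFam (p : C × C) : V := EnrichedCategory.Hom p.1 p.2 ⊗ F.obj (op p.2)

/-- The summand `C(A, B) × C(B, D) × F D` of the object of composable pairs. -/
abbrev pairFam (t : C × C × C) : V :=
  EnrichedCategory.Hom t.1 t.2.1 ⊗ (EnrichedCategory.Hom t.2.1 t.2.2 ⊗ F.obj (op t.2.2))

/-- The object of objects `∐_A F A` of the internal category of elements. -/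
noncomputable def ob : V := ∐ obFam F

/-- The object of morphisms `∐_{A, B} C(A, B) × F B` of the internal category of elements. -/
noncomputable def mor : V := ∐ morFam F

/-- The object `∐_{A, B, D} C(A, B) × C(B, D) × F D`. -/
noncomputable def pair : V := ∐ pairFam F

/-- The coproduct inclusion of `F A`. -/
noncomputable def ιOb (A : C) : F.obj (op A) ⟶ ob F := Sigma.ι (obFam F) A

/-- The coproduct inclusion of `C(A, B) × F B`. -/
noncomputable def ιMor (A B : C) : (EnrichedCategory.Hom A B : V) ⊗ F.obj (op B) ⟶ mor F :=
  Sigma.ι (morFam F) (A, B)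

/-- The coproduct inclusion of `C(A, B) × C(B, D) × F D`. -/
noncomputable def ιPair (A B D : C) : (EnrichedCategory.Hom A B : V) ⊗
    ((EnrichedCategory.Hom B D : V) ⊗ F.obj (op D)) ⟶ pair F :=
  Sigma.ι (pairFam F) (A, B, D)

/-- The map out of `∐_A F A` with given components. -/
noncomputable def descOb {T : V} (d : ∀ A : C, F.obj (op A) ⟶ T) : ob F ⟶ T := Sigma.desc d

/-- The map out of `∐_{A, B} C(A, B) × F B` with given components. -/
noncomputable def descMor {T : V}
    (d : ∀ A B : C, (EnrichedCategory.Hom A B : V) ⊗ F.obj (op B) ⟶ T) : mor F ⟶ T :=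
  Sigma.desc fun p => d p.1 p.2

/-- The map out of `∐_{A, B, D} C(A, B) × C(B, D) × F D` with given components. -/
noncomputable def descPair {T : V}
    (d : ∀ A B D : C, (EnrichedCategory.Hom A B : V) ⊗
      ((EnrichedCategory.Hom B D : V) ⊗ F.obj (op D)) ⟶ T) : pair F ⟶ T :=
  Sigma.desc fun t => d t.1 t.2.1 t.2.2

theorem ιOb_desc {T : V} (d : ∀ A : C, F.obj (op A) ⟶ T) (A : C) :
    ιOb F A ≫ descOb F d = d A := Sigma.ι_desc _ _

theorem ιMor_desc {T : V} (d : ∀ A B : C, (EnrichedCategory.Hom A B : V) ⊗ F.obj (op B) ⟶ T)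
    (A B : C) : ιMor F A B ≫ descMor F d = d A B := Sigma.ι_desc _ _

theorem ιPair_desc {T : V} (d : ∀ A B D : C, (EnrichedCategory.Hom A B : V) ⊗
    ((EnrichedCategory.Hom B D : V) ⊗ F.obj (op D)) ⟶ T) (A B D : C) :
    ιPair F A B D ≫ descPair F d = d A B D := Sigma.ι_desc _ _

variable {F} in
/-- The generalized morphism of elements with components `f` and `y`. -/
noncomputable def mkMor {W : V} {A B : C} (f : W ⟶ EnrichedCategory.Hom A B)
    (y : W ⟶ F.obj (op B)) : W ⟶ mor F :=
  lift f y ≫ ιMor F A B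

variable {F} in
/-- The generalized composable pair of morphisms of elements with components `f`, `g`, `y`. -/
noncomputable def mkPair {W : V} {A B D : C} (f : W ⟶ EnrichedCategory.Hom A B)
    (g : W ⟶ EnrichedCategory.Hom B D) (y : W ⟶ F.obj (op D)) : W ⟶ pair F :=
  lift f (lift g y) ≫ ιPair F A B D

theorem comp_mkMor {W W' : V} (z : W' ⟶ W) {A B : C} (f : W ⟶ EnrichedCategory.Hom A B)
    (y : W ⟶ F.obj (op B)) : z ≫ mkMor f y = mkMor (z ≫ f) (z ≫ y) := by
  rw [mkMor, comp_lift_assoc, mkMor]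

theorem comp_mkPair {W W' : V} (z : W' ⟶ W) {A B D : C} (f : W ⟶ EnrichedCategory.Hom A B)
    (g : W ⟶ EnrichedCategory.Hom B D) (y : W ⟶ F.obj (op D)) :
    z ≫ mkPair f g y = mkPair (z ≫ f) (z ≫ g) (z ≫ y) := by
  rw [mkPair, comp_lift_assoc, comp_lift, mkPair]

theorem comp_ιMor {W : V} {A B : C} (m : W ⟶ (EnrichedCategory.Hom A B : V) ⊗ F.obj (op B)) :
    m ≫ ιMor F A B = mkMor (m ≫ fst _ _) (m ≫ snd _ _) := by
  rw [mkMor, ← comp_lift, lift_fst_snd, Category.comp_id]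

theorem comp_ιPair {W : V} {A B D : C} (m : W ⟶ (EnrichedCategory.Hom A B : V) ⊗
    ((EnrichedCategory.Hom B D : V) ⊗ F.obj (op D))) : m ≫ ιPair F A B D =
      mkPair (m ≫ fst _ _) (m ≫ snd _ _ ≫ fst _ _) (m ≫ snd _ _ ≫ snd _ _) := by
  rw [mkPair, ← comp_lift, ← comp_lift, ← comp_lift, lift_fst_snd, Category.comp_id,
    lift_fst_snd, Category.comp_id]

/-- The source map, given by the maps `C(A, B) × F B ⟶ F A`. -/
noncomputable def src : mor F ⟶ ob F := descMor F fun A B => evMap F A B ≫ ιOb F A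

/-- The target map, given by the projections `C(A, B) × F B ⟶ F B`. -/
noncomputable def tgt : mor F ⟶ ob F := descMor F fun _ B => snd _ _ ≫ ιOb F B

/-- The identity map, given by the identities `1 ⟶ C(A, A)`. -/
noncomputable def ident : ob F ⟶ mor F :=
  descOb F fun A => mkMor (toUnit _ ≫ eId V A) (𝟙 (F.obj (op A)))

/-- The first morphism of a composable pair. -/
noncomputable def pairFst : pair F ⟶ mor F :=
  descPair F fun _ B D => mkMor (fst _ _) (snd _ _ ≫ evMap F B D)

/-- The second morphism of a composable pair. -/
noncomputable def pairSnd : pair F ⟶ mor F :=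
  descPair F fun _ _ _ => mkMor (snd _ _ ≫ fst _ _) (snd _ _ ≫ snd _ _)

/-- The composite of a composable pair, given by composition in `C`. -/
noncomputable def pairComp : pair F ⟶ mor F :=
  descPair F fun _ _ _ => mkMor (eCompose (fst _ _) (snd _ _ ≫ fst _ _)) (snd _ _ ≫ snd _ _)

section

variable {F} {W : V} {A B D : C} (f : W ⟶ EnrichedCategory.Hom A B)
  (g : W ⟶ EnrichedCategory.Hom B D)

theorem mkMor_src (y : W ⟶ F.obj (op B)) :
    mkMor f y ≫ src F = (lift f y ≫ evMap F A B) ≫ ιOb F A := by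
  rw [mkMor, src, Category.assoc, Category.assoc, ιMor_desc]

theorem mkMor_tgt (y : W ⟶ F.obj (op B)) : mkMor f y ≫ tgt F = y ≫ ιOb F B := by
  rw [mkMor, tgt, Category.assoc, ιMor_desc, lift_snd_assoc]

theorem ιOb_ident (y : W ⟶ F.obj (op B)) :
    (y ≫ ιOb F B) ≫ ident F = mkMor (toUnit _ ≫ eId V B) y := by
  rw [ident, Category.assoc, ιOb_desc, comp_mkMor, comp_toUnit_assoc, Category.comp_id]

theorem mkPair_fst (y : W ⟶ F.obj (op D)) :
    mkPair f g y ≫ pairFst F = mkMor f (lift g y ≫ evMap F B D) := by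
  rw [mkPair, pairFst, Category.assoc, ιPair_desc, comp_mkMor, lift_fst, lift_snd_assoc]

theorem mkPair_snd (y : W ⟶ F.obj (op D)) : mkPair f g y ≫ pairSnd F = mkMor g y := by
  rw [mkPair, pairSnd, Category.assoc, ιPair_desc, comp_mkMor, lift_snd_assoc, lift_snd_assoc,
    lift_fst, lift_snd]

theorem mkPair_comp (y : W ⟶ F.obj (op D)) :
    mkPair f g y ≫ pairComp F = mkMor (eCompose f g) y := by
  rw [mkPair, pairComp, Category.assoc, ιPair_desc, comp_mkMor, comp_eCompose, lift_snd_assoc,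
    lift_snd_assoc, lift_fst, lift_fst, lift_snd]

end

theorem ob_hom_ext {T : V} {a b : ob F ⟶ T} (h : ∀ A : C, ιOb F A ≫ a = ιOb F A ≫ b) : a = b :=
  Sigma.hom_ext _ _ h

theorem mor_hom_ext {T : V} {a b : mor F ⟶ T}
    (h : ∀ (W : V) (A B : C) (f : W ⟶ EnrichedCategory.Hom A B) (y : W ⟶ F.obj (op B)),
      mkMor f y ≫ a = mkMor f y ≫ b) : a = b :=
  Sigma.hom_ext _ _ fun p => by
    have e := comp_ιMor F (𝟙 ((EnrichedCategory.Hom p.1 p.2 : V) ⊗ F.obj (op p.2)))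
    rw [Category.id_comp] at e
    exact (congrArg (· ≫ a) e).trans ((h _ _ _ _ _).trans (congrArg (· ≫ b) e.symm))

theorem pair_hom_ext {T : V} {a b : pair F ⟶ T}
    (h : ∀ (W : V) (A B D : C) (f : W ⟶ EnrichedCategory.Hom A B)
      (g : W ⟶ EnrichedCategory.Hom B D) (y : W ⟶ F.obj (op D)),
      mkPair f g y ≫ a = mkPair f g y ≫ b) : a = b :=
  Sigma.hom_ext _ _ fun t => by
    have e := comp_ιPair F (𝟙 ((EnrichedCategory.Hom t.1 t.2.1 : V) ⊗
      ((EnrichedCategory.Hom t.2.1 t.2.2 : V) ⊗ F.obj (op t.2.2))))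
    rw [Category.id_comp] at e
    exact (congrArg (· ≫ a) e).trans ((h _ _ _ _ _ _ _).trans (congrArg (· ≫ b) e.symm))

theorem pair_condition : pairFst F ≫ tgt F = pairSnd F ≫ src F :=
  pair_hom_ext F fun W A B D f g y => by
    rw [← Category.assoc, ← Category.assoc, mkPair_fst, mkPair_snd, mkMor_tgt, mkMor_src]

variable [IsExtensive.{w} V]

theorem mor_cover {X T : V} (m : X ⟶ mor F) {a b : X ⟶ T}
    (H : ∀ (W : V) (z : W ⟶ X) (A B : C) (f : W ⟶ EnrichedCategory.Hom A B)
      (y : W ⟶ F.obj (op B)), z ≫ m = mkMor f y → z ≫ a = z ≫ b) : a = b :=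
  hom_ext_of_cover (Y := morFam F) m fun p W z g h => H W z p.1 p.2 (g ≫ fst _ _) (g ≫ snd _ _)
    (h.trans (comp_ιMor F g))

theorem pair_cover {X T : V} (m : X ⟶ pair F) {a b : X ⟶ T}
    (H : ∀ (W : V) (z : W ⟶ X) (A B D : C) (f : W ⟶ EnrichedCategory.Hom A B)
      (g : W ⟶ EnrichedCategory.Hom B D) (y : W ⟶ F.obj (op D)),
      z ≫ m = mkPair f g y → z ≫ a = z ≫ b) : a = b :=
  hom_ext_of_cover (Y := pairFam F) m fun _ W z g h => H W z _ _ _ _ _ _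
    (h.trans (comp_ιPair F g))

theorem ιOb_eq {W : V} {A B : C} {x : W ⟶ F.obj (op A)} {y : W ⟶ F.obj (op B)}
    (h : x ≫ ιOb F A = y ≫ ιOb F B) (hAB : A ≠ B) (T : V) : Nonempty (Unique (W ⟶ T)) :=
  sigma_ι_disjoint (Y := obFam F) hAB h

theorem ιOb_cancel {W : V} {A : C} {x y : W ⟶ F.obj (op A)}
    (h : x ≫ ιOb F A = y ≫ ιOb F A) : x = y :=
  sigma_ι_cancel (Y := obFam F) h

theorem mkMor_eq {W : V} {A B A' B' : C} {f : W ⟶ EnrichedCategory.Hom A B}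
    {y : W ⟶ F.obj (op B)} {f' : W ⟶ EnrichedCategory.Hom A' B'} {y' : W ⟶ F.obj (op B')}
    (h : mkMor f y = mkMor f' y') (hp : (A, B) ≠ (A', B')) (T : V) :
    Nonempty (Unique (W ⟶ T)) :=
  sigma_ι_disjoint (Y := morFam F) hp h

theorem mkMor_cancel {W : V} {A B : C} {f f' : W ⟶ EnrichedCategory.Hom A B}
    {y y' : W ⟶ F.obj (op B)} (h : mkMor f y = mkMor f' y') : f = f' ∧ y = y' := by
  have e : lift f y = lift f' y' := sigma_ι_cancel (Y := morFam F) (i := (A, B)) h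
  exact ⟨by simpa using e =≫ fst _ _, by simpa using e =≫ snd _ _⟩

theorem pair_ext {X : V} {k k' : X ⟶ pair F} (h₁ : k ≫ pairFst F = k' ≫ pairFst F)
    (h₂ : k ≫ pairSnd F = k' ≫ pairSnd F) : k = k' := by
  refine pair_cover F k fun W z A B D f g y hz => ?_
  refine pair_cover F (z ≫ k') fun W' z' A' B' D' f' g' y' hz' => ?_
  have e₁ := congrArg (fun t => z' ≫ z ≫ t) h₁
  have e₂ := congrArg (fun t => z' ≫ z ≫ t) h₂
  have hz₀ : z' ≫ z ≫ k = mkPair (z' ≫ f) (z' ≫ g) (z' ≫ y) := by rw [hz, comp_mkPair]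
  simp only [← Category.assoc] at e₁ e₂ hz₀ hz' ⊢
  rw [hz₀, hz', mkPair_fst, mkPair_fst] at e₁
  rw [hz₀, hz', mkPair_snd, mkPair_snd] at e₂
  rw [hz₀, hz']
  by_cases hp : (A, B) = (A', B')
  · by_cases hq : (B, D) = (B', D')
    · obtain ⟨rfl, rfl⟩ := Prod.mk.inj hp
      obtain ⟨-, rfl⟩ := Prod.mk.inj hq
      rw [(mkMor_cancel F e₁).1, (mkMor_cancel F e₂).1, (mkMor_cancel F e₂).2]
    · obtain ⟨h⟩ := mkMor_eq F e₂ hq (pair F)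
      exact Subsingleton.elim _ _
  · obtain ⟨h⟩ := mkMor_eq F e₁ hp (pair F)
    exact Subsingleton.elim _ _

theorem exists_pair {X : V} {m n : X ⟶ mor F} (h : m ≫ tgt F = n ≫ src F) :
    ∃ k : X ⟶ pair F, k ≫ pairFst F = m ∧ k ≫ pairSnd F = n := by
  suffices H : ∃ k : X ⟶ pair F, k ≫ lift (pairFst F) (pairSnd F) = lift m n by
    obtain ⟨k, hk⟩ := H
    exact ⟨k, by simpa using hk =≫ fst _ _, by simpa using hk =≫ snd _ _⟩
  refine exists_lift_of_cover (Y := morFam F) m _ _ fun p W z a hz => ?_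
  refine exists_lift_of_cover (Y := morFam F) (z ≫ n) _ _ fun q W' z' b hz' => ?_
  obtain ⟨A, B⟩ := p
  obtain ⟨B', D⟩ := q
  have hz₁ : z ≫ m = mkMor (a ≫ fst _ _) (a ≫ snd _ _) := hz.trans (comp_ιMor F a)
  have hm : z' ≫ z ≫ m = mkMor (z' ≫ a ≫ fst _ _) (z' ≫ a ≫ snd _ _) := by
    rw [hz₁, comp_mkMor]
  have hn : z' ≫ z ≫ n = mkMor (b ≫ fst _ _) (b ≫ snd _ _) := hz'.trans (comp_ιMor F b)
  have e := congrArg (fun t => z' ≫ z ≫ t) h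
  simp only [← Category.assoc] at e hm hn ⊢
  rw [hm, hn, mkMor_tgt, mkMor_src] at e
  by_cases hB : B = B'
  · subst hB
    have e' := ιOb_cancel F e
    refine ⟨mkPair ((z' ≫ a) ≫ fst _ _) (b ≫ fst _ _) (b ≫ snd _ _), ?_⟩
    rw [comp_lift, comp_lift, mkPair_fst, mkPair_snd, hm, hn, ← e']
  · obtain ⟨h₁⟩ := ιOb_eq F e hB (pair F)
    obtain ⟨h₂⟩ := ιOb_eq F e hB (mor F ⊗ mor F)
    exact ⟨default, Subsingleton.elim _ _⟩

theorem isPullback : IsPullback (pairFst F) (pairSnd F) (tgt F) (src F) where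
  w := pair_condition F
  isLimit' := ⟨PullbackCone.IsLimit.mk _
    (fun s => (exists_pair F s.condition).choose)
    (fun s => (exists_pair F s.condition).choose_spec.1)
    (fun s => (exists_pair F s.condition).choose_spec.2)
    (fun s _ h₁ h₂ => pair_ext F
      (h₁.trans (exists_pair F s.condition).choose_spec.1.symm)
      (h₂.trans (exists_pair F s.condition).choose_spec.2.symm))⟩

variable [HasPullbacks V]

/-- The composition map, under the identification of the object of composable pairs with
`∐_{A, B, D} C(A, B) × C(B, D) × F D`. -/
noncomputable def comp : pullback (tgt F) (src F) ⟶ mor F :=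
  (isPullback F).isoPullback.inv ≫ pairComp F

theorem isoPullback_comp : (isPullback F).isoPullback.hom ≫ comp F = pairComp F :=
  Iso.hom_inv_id_assoc _ _

theorem lift_comp {W : V} {A B D : C} (f : W ⟶ EnrichedCategory.Hom A B)
    (g : W ⟶ EnrichedCategory.Hom B D) (y : W ⟶ F.obj (op D)) {m n : W ⟶ mor F}
    (hm : m = mkMor f (lift g y ≫ evMap F B D)) (hn : n = mkMor g y)
    (h : m ≫ tgt F = n ≫ src F) :
    pullback.lift m n h ≫ comp F = mkMor (eCompose f g) y := by
  rw [← mkPair_comp, ← isoPullback_comp, ← Category.assoc]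
  congr 1
  ext
  · rw [pullback.lift_fst, Category.assoc, IsPullback.isoPullback_hom_fst, mkPair_fst, hm]
  · rw [pullback.lift_snd, Category.assoc, IsPullback.isoPullback_hom_snd, mkPair_snd, hn]

theorem comp_lift_comp {W X : V} (z : W ⟶ X) {m n : X ⟶ mor F} (h : m ≫ tgt F = n ≫ src F)
    {m' n' : W ⟶ mor F} (hm : z ≫ m = m') (hn : z ≫ n = n') :
    z ≫ pullback.lift m n h ≫ comp F = pullback.lift m' n'
      (by rw [← hm, ← hn, Category.assoc, Category.assoc, h]) ≫ comp F := by
  rw [← Category.assoc]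
  congr 1
  ext <;> simp [hm, hn]

end Elements

open Elements

variable [IsExtensive.{w} V] [HasPullbacks V]

/-- The internal category of elements of a `V`-functor `F : Cᵒᵖ ⥤ V`. -/
noncomputable def elements : InternalCat V where
  ob := Elements.ob F
  mor := Elements.mor F
  src := Elements.src F
  tgt := Elements.tgt F
  comp := Elements.comp F
  ident := Elements.ident F
  ident_src := ob_hom_ext F fun A => by
    have e := ιOb_ident (F := F) (𝟙 (F.obj (op A)))
    rw [Category.id_comp] at e
    rw [← Category.assoc, e, mkMor_src, eId_evMap, Category.id_comp, Category.comp_id]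
  ident_tgt := ob_hom_ext F fun A => by
    have e := ιOb_ident (F := F) (𝟙 (F.obj (op A)))
    rw [Category.id_comp] at e
    rw [← Category.assoc, e, mkMor_tgt, Category.id_comp, Category.comp_id]
  comp_src := by
    rw [← cancel_epi (isPullback F).isoPullback.hom]
    rw [← Category.assoc, isoPullback_comp, IsPullback.isoPullback_hom_fst_assoc]
    refine pair_hom_ext F fun W A B D f g y => ?_
    rw [← Category.assoc, ← Category.assoc, mkPair_comp, mkPair_fst, mkMor_src, mkMor_src,
      eCompose_evMap]
  comp_tgt := by
    rw [← cancel_epi (isPullback F).isoPullback.hom]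
    rw [← Category.assoc, isoPullback_comp, IsPullback.isoPullback_hom_snd_assoc]
    refine pair_hom_ext F fun W A B D f g y => ?_
    rw [← Category.assoc, ← Category.assoc, mkPair_comp, mkPair_snd, mkMor_tgt, mkMor_tgt]
  ident_comp := by
    refine mor_hom_ext F fun W A B f y => ?_
    refine (comp_lift_comp F _ _ rfl rfl).trans ?_
    refine (lift_comp F (toUnit _ ≫ eId V A) f y ?_ (Category.comp_id _) _).trans ?_
    · rw [← Category.assoc, mkMor_src, ιOb_ident]
    · rw [id_eCompose, Category.comp_id]
  comp_ident := by
    refine mor_hom_ext F fun W A B f y => ?_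
    refine (comp_lift_comp F _ _ rfl rfl).trans ?_
    refine (lift_comp F f (toUnit _ ≫ eId V B) y ?_ ?_ _).trans ?_
    · rw [Category.comp_id, eId_evMap]
    · rw [← Category.assoc, mkMor_tgt, ιOb_ident]
    · rw [eCompose_id, Category.comp_id]
  assoc := by
    refine InternalCat.assoc_of_forall (fun X m n k h h' h₁ h₂ => ?_) rfl rfl _ _
    refine mor_cover F m fun W₁ z₁ A B f y hm => ?_
    refine mor_cover F (z₁ ≫ n) fun W₂ z₂ B' D g y' hn => ?_
    refine mor_cover F (z₂ ≫ z₁ ≫ k) fun W₃ z₃ D' E l y'' hk => ?_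
    have hm' : (z₃ ≫ z₂ ≫ z₁) ≫ m = mkMor (z₃ ≫ z₂ ≫ f) (z₃ ≫ z₂ ≫ y) := by
      simp only [Category.assoc, hm, comp_mkMor]
    have hn' : (z₃ ≫ z₂ ≫ z₁) ≫ n = mkMor (z₃ ≫ g) (z₃ ≫ y') := by
      simp only [Category.assoc, hn, comp_mkMor]
    have hk' : (z₃ ≫ z₂ ≫ z₁) ≫ k = mkMor l y'' := by
      simp only [Category.assoc, hk]
    have eh := congrArg ((z₃ ≫ z₂ ≫ z₁) ≫ ·) h
    have eh' := congrArg ((z₃ ≫ z₂ ≫ z₁) ≫ ·) h'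
    simp only [← Category.assoc _ m, ← Category.assoc _ n, ← Category.assoc _ k] at eh eh'
    rw [hm', hn', mkMor_tgt, mkMor_src] at eh
    rw [hn', hk', mkMor_tgt, mkMor_src] at eh'
    have key : (z₃ ≫ z₂ ≫ z₁) ≫ pullback.lift (pullback.lift m n h ≫ comp F) k h₁ ≫ comp F =
        (z₃ ≫ z₂ ≫ z₁) ≫ pullback.lift m (pullback.lift n k h' ≫ comp F) h₂ ≫ comp F := by
      by_cases hB : B = B'
      · by_cases hD : D = D'
        · subst hB hD
          have ey := ιOb_cancel F eh
          have ey' := ιOb_cancel F eh'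
          have i₁ : (z₃ ≫ z₂ ≫ z₁) ≫ pullback.lift m n h ≫ comp F =
              mkMor (eCompose (z₃ ≫ z₂ ≫ f) (z₃ ≫ g)) (z₃ ≫ y') :=
            (comp_lift_comp F _ _ rfl rfl).trans
              (lift_comp F _ _ _ (by rw [hm', ey]) hn' _)
          have i₂ : (z₃ ≫ z₂ ≫ z₁) ≫ pullback.lift n k h' ≫ comp F =
              mkMor (eCompose (z₃ ≫ g) l) y'' :=
            (comp_lift_comp F _ _ rfl rfl).trans
              (lift_comp F _ _ _ (by rw [hn', ey']) hk' _)
          refine (comp_lift_comp F _ _ rfl rfl).trans ((lift_comp F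
            (eCompose (z₃ ≫ z₂ ≫ f) (z₃ ≫ g)) l y'' (by rw [i₁, ey']) hk' _).trans ?_)
          refine Eq.symm ((comp_lift_comp F _ _ rfl rfl).trans ((lift_comp F
            (z₃ ≫ z₂ ≫ f) (eCompose (z₃ ≫ g) l) y'' ?_ i₂ _).trans ?_))
          · rw [hm', ey, eCompose_evMap, ey']
          · rw [eCompose_assoc]
        · obtain ⟨hu⟩ := ιOb_eq F eh' hD (mor F)
          exact Subsingleton.elim _ _
      · obtain ⟨hu⟩ := ιOb_eq F eh hB (mor F)
        exact Subsingleton.elim _ _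
    simpa only [Category.assoc] using key

end Elements

section GeneralizedElements

variable {V : Type u} [Category.{v} V] [HasPullbacks V]

/-- A generalized element `X ⟶ A₀` of the object of objects of an internal category `A`, as an
internal functor `cst X ⟶ A`. -/
noncomputable def InternalCat.cstTo (A : InternalCat V) {X : V} (a : X ⟶ A.ob) :
    cst X ⟶ A where
  onOb := a
  onMor := a ≫ A.ident
  map_src := (Category.assoc a A.ident A.src).trans ((congrArg (a ≫ ·) A.ident_src).trans
    ((Category.comp_id a).trans (Category.id_comp a).symm))
  map_tgt := (Category.assoc a A.ident A.tgt).trans ((congrArg (a ≫ ·) A.ident_tgt).trans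
    ((Category.comp_id a).trans (Category.id_comp a).symm))
  map_ident := Category.id_comp _
  map_comp := by
    have h : pullback.snd (𝟙 X) (𝟙 X) = pullback.fst (𝟙 X) (𝟙 X) := by
      simpa using (pullback.condition (f := 𝟙 X) (g := 𝟙 X)).symm
    have e := A.compose_ident (pullback.fst (𝟙 X) (𝟙 X) ≫ a ≫ A.ident)
    refine e.symm.trans (InternalCat.compose_congr rfl ?_ _)
    refine Eq.trans ?_ (congrArg (· ≫ a ≫ A.ident) h.symm)
    simp

variable [CartesianMonoidalCategory V]

/-- An element `1 ⟶ A` of an internal category `A`, as an object of the `V`-category underlying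
`A`. -/
def Und.ofElement {A : InternalCat V} (T : 𝟙_ (InternalCat V) ⟶ A) : Und A where
  elt := T.onOb

/-- The `V`-category `Und ⟦cst X, A⟧` of generalized elements of `A` of shape `X`. -/
abbrev GenElt [MonoidalClosed V] (X : V) (A : InternalCat V) :=
  Und ((ihom (InternalCat.cst X)).obj A)

/-- An element `T : 1 ⟶ A` of an internal category `A`, seen as an object of
`Und ⟦cst X, A⟧` by means of the composite `1 ⟶ A ⟶ ⟦cst X, A⟧`. -/
noncomputable def GenElt.ofElement [MonoidalClosed V] (X : V) {A : InternalCat V}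
    (T : 𝟙_ (InternalCat V) ⟶ A) : GenElt X A :=
  Und.ofElement (T ≫ InternalCat.diag X A)

/-- The object of `Und ⟦cst X, A⟧` obtained from `a : 1 ⟶ A₀` is given by the map `1 ⟶ [X, A₀]`
whose transpose is `X × 1 ⟶ 1 ⟶ A₀`. -/
theorem GenElt.ofElement_elt [MonoidalClosed V] (X : V) {A : InternalCat V}
    (T : 𝟙_ (InternalCat V) ⟶ A) : (GenElt.ofElement X T).elt =
      MonoidalClosed.curry (A := X) (Y := 𝟙_ V) (X := A.ob) (snd X (𝟙_ V) ≫ T.onOb) :=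
  (congrArg (T.onOb ≫ ·) (congrArg InternalFunctor.onOb
    (InternalCat.curry_eq_powEquiv X (snd (InternalCat.cst X) A)))).trans
      ((MonoidalClosed.curry_natural_left (A := X) (X := 𝟙_ V) (X' := A.ob) T.onOb
        (snd X A.ob)).symm.trans
          (congrArg (MonoidalClosed.curry (A := X)) (whiskerLeft_snd X T.onOb)))

/-- The element `(c, x) : 1 ⟶ ∫ F` of the internal category of elements, for `x : 1 ⟶ F c`. -/
noncomputable def elementsPair [BraidedCategory V] [MonoidalClosed V] [HasCoproducts.{w} V]
    [IsExtensive.{w} V] {C : Type w} [EnrichedCategory V C] (F : EnrichedFunctor V Cᵒᵖ V) (c : C)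
    (x : 𝟙_ V ⟶ F.obj (op c)) : 𝟙_ (InternalCat V) ⟶ elements F :=
  (elements F).cstTo (x ≫ Elements.ιOb F c)

end GeneralizedElements

end VRep

/-!
The components of the transformation `α_x : C(-, c) ⇒ F` are the maps
`φ_A : C(A, c) ⟶ F A`, `f ↦ F(f)(x)`, and `F` is representable by `(c, x)` exactly when every
`φ_A` is invertible (`isVRepresentableBy_iff`).

On the other side, unwinding the pullback defining the hom-objects of `Und ⟦cst X, A⟧` and
transposing across `X × -`, an element `T` is `V`-terminal precisely when for each `b : X ⟶ A₀` and
each `W` there is a unique generalized morphism `X × W ⟶ A₁` with source `b ∘ fst` and constant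
target `T` (`GenElt.isVTerminal_ofElement_iff`). In the category of elements, a generalized
morphism with constant target `(c, x)` is, locally on a coproduct decomposition of its domain, a
generalized element `f` of some `C(A, c)`, and its source is then `φ_A ∘ f` in the summand `F A`.

If all `φ_A` are invertible, their inverses therefore assemble to a map `∐_A F A ⟶ (∫ F)₁` which
picks the unique morphism to `(c, x)`. Conversely, taking `W = 1` and `b` to factor through a single
summand `F A`, terminality says that composition with `φ_A` is bijective on generalized elements of
shape `X`; when `X` ranges over a conservative family this makes `φ_A` invertible. Extensivity
enters through the disjointness of the summands: a piece of the decomposition on which two distinct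
summands meet is initial and may be disregarded.
-/

namespace VRep

/-! ### Natural isomorphisms of presheaves -/

section Presheaf

variable {V : Type u} [Category.{v} V] [CartesianMonoidalCategory V] [MonoidalClosed V]

theorem uncurry'_eCompose {X Y Z : V} (f : 𝟙_ V ⟶ EnrichedCategory.Hom X Y)
    (g : 𝟙_ V ⟶ EnrichedCategory.Hom Y Z) :
    MonoidalClosed.uncurry' (X := X) (Y := Z) (eCompose f g) =
      MonoidalClosed.uncurry' (X := X) (Y := Y) f ≫
        MonoidalClosed.uncurry' (X := Y) (Y := Z) g := by
  have hg : MonoidalClosed.uncurry (A := Y) (Y := 𝟙_ V) g =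
      fst Y (𝟙_ V) ≫ MonoidalClosed.uncurry' (X := Y) (Y := Z) g := by
    have e := uncurry_toUnit_comp (W := 𝟙_ V) (X := Y) (Y := Z) g
    rwa [toUnit_unique (toUnit (𝟙_ V)) (𝟙 _), Category.id_comp] at e
  refine (congrArg ((ρ_ X).inv ≫ ·) (uncurry_eCompose f g)).trans ?_
  refine (congrArg (fun t => (ρ_ X).inv ≫ lift _ _ ≫ t) hg).trans ?_
  rw [lift_fst_assoc, ← Category.assoc]
  rfl

variable [BraidedCategory V] {C : Type w} [EnrichedCategory V C]

theorem VNatTrans.evApp_comp {F G H : EnrichedFunctor V Cᵒᵖ V} (α : VNatTrans F G)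
    (β : VNatTrans G H) (A : C) : (α.comp β).evApp A = α.evApp A ≫ β.evApp A :=
  uncurry'_eCompose _ _

theorem VNatTrans.evApp_id (F : EnrichedFunctor V Cᵒᵖ V) (A : C) :
    (VNatTrans.id F).evApp A = 𝟙 _ := by
  refine (congrArg MonoidalClosed.uncurry' ?_).trans (MonoidalClosed.uncurry'_curry' _)
  exact (MonoidalClosed.curry'_id _).symm

theorem VNatTrans.isVNatIso_iff {F G : EnrichedFunctor V Cᵒᵖ V} (α : VNatTrans F G) :
    α.IsVNatIso ↔ ∀ A : C, IsIso (α.evApp A) := by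
  constructor
  · rintro ⟨β, h₁, h₂⟩ A
    refine ⟨β.evApp A, ?_, ?_⟩
    · rw [← evApp_comp, h₁, evApp_id]
    · rw [← evApp_comp, h₂, evApp_id]
  · intro h
    have nat (A B : C) : evMap G A B ≫ inv (α.evApp A) =
        EnrichedCategory.Hom A B ◁ inv (α.evApp B) ≫ evMap F A B := by
      rw [IsIso.comp_inv_eq, Category.assoc, evMap_evApp, ← MonoidalCategory.whiskerLeft_comp_assoc,
        IsIso.inv_hom_id, MonoidalCategory.whiskerLeft_id, Category.id_comp]
    refine ⟨ofEvApp (fun A => inv (α.evApp A)) nat, ext_evApp fun A => ?_, ext_evApp fun A => ?_⟩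
    · rw [evApp_comp, ofEvApp_evApp, IsIso.hom_inv_id, evApp_id]
    · rw [evApp_comp, ofEvApp_evApp, IsIso.inv_hom_id, evApp_id]

variable (F : EnrichedFunctor V Cᵒᵖ V) (c : C) (x : 𝟙_ V ⟶ F.obj (op c))

/-- The map `C(A, c) ⟶ F A`, informally `f ↦ F(f)(x)`, underlying the component at `A` of
`yonedaTrans F c x`. -/
def yonedaApp (A : C) : EnrichedCategory.Hom A c ⟶ F.obj (op A) :=
  lift (𝟙 _) (toUnit _ ≫ x) ≫ evMap F A c

variable {c} in
theorem comp_yonedaApp {W : V} {A : C} (f : W ⟶ EnrichedCategory.Hom A c) :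
    f ≫ yonedaApp F c x A = lift f (toUnit W ≫ x) ≫ evMap F A c := by
  rw [yonedaApp, comp_lift_assoc, Category.comp_id, comp_toUnit_assoc]

theorem isVRepresentableBy_iff :
    IsVRepresentableBy F c x ↔ ∀ A : C, IsIso (yonedaApp F c x A) := by
  refine (VNatTrans.isVNatIso_iff _).trans (forall_congr' fun A => ?_)
  rw [yonedaTrans_evApp]
  rfl

end Presheaf

/-! ### Terminal generalized elements -/

section Terminal

variable {V : Type u} [Category.{v} V] [CartesianMonoidalCategory V]

theorem isIso_toUnit_iff {X : V} :
    IsIso (toUnit X) ↔ ∀ W : V, ∃! f : W ⟶ X, f ≫ toUnit X = toUnit W := by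
  constructor
  · intro h W
    exact ⟨toUnit W ≫ inv (toUnit X), toUnit_unique _ _,
      fun f hf => by rw [← hf, Category.assoc, IsIso.hom_inv_id, Category.comp_id]⟩
  · intro h
    obtain ⟨s, -, -⟩ := h (𝟙_ V)
    exact ⟨s, (h X).unique (toUnit_unique _ _) (toUnit_unique _ _), toUnit_unique _ _⟩

variable [HasPullbacks V]

theorem Und.isVTerminal_iff {A : InternalCat V} (b : Und A) :
    IsVTerminal (V := V) b ↔ ∀ (a : Und A) (W : V), ∃! m : W ⟶ A.mor,
      m ≫ A.src = toUnit W ≫ a.elt ∧ m ≫ A.tgt = toUnit W ≫ b.elt := by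
  refine forall_congr' fun a => isIso_toUnit_iff.trans (forall_congr' fun W => ?_)
  have hs (f : W ⟶ hom a b) : (f ≫ π a b) ≫ A.src = toUnit W ≫ a.elt := by
    rw [Category.assoc, π_src, comp_toUnit_assoc]
  have ht (f : W ⟶ hom a b) : (f ≫ π a b) ≫ A.tgt = toUnit W ≫ b.elt := by
    rw [Category.assoc, π_tgt, comp_toUnit_assoc]
  constructor
  · rintro ⟨f, -, hf⟩
    refine ⟨f ≫ π a b, ⟨hs f, ht f⟩, fun m hm => ?_⟩
    rw [← hf (mkHom m hm.1 hm.2) (toUnit_unique _ _), mkHom_π]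
  · rintro ⟨m, hm, h⟩
    refine ⟨mkHom m hm.1 hm.2, toUnit_unique _ _, fun f _ => Und.hom_ext ?_⟩
    rw [mkHom_π]
    exact h _ ⟨hs f, ht f⟩

variable [MonoidalClosed V]

theorem comp_ihom_map_eq_iff {X Y Z W : V} (m : W ⟶ (ihom X).obj Y) (s : Y ⟶ Z)
    (b : X ⊗ 𝟙_ V ⟶ Z) :
    m ≫ (ihom X).map s = toUnit W ≫ MonoidalClosed.curry b ↔
      MonoidalClosed.uncurry m ≫ s = X ◁ toUnit W ≫ b := by
  rw [← MonoidalClosed.curry_natural_left, ← InternalCat.uncurry_comp_ihom_map,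
    MonoidalClosed.eq_curry_iff]

/-- Terminality of an element `T` among the generalized elements of shape `X`, stated by means of
generalized morphisms `X × W ⟶ A₁`. -/
theorem GenElt.isVTerminal_ofElement_iff (X : V) {A : InternalCat V}
    (T : 𝟙_ (InternalCat V) ⟶ A) :
    IsVTerminal (V := V) (GenElt.ofElement X T) ↔ ∀ (b : X ⟶ A.ob) (W : V),
      ∃! m : X ⊗ W ⟶ A.mor, m ≫ A.src = fst X W ≫ b ∧
        m ≫ A.tgt = toUnit (X ⊗ W) ≫ T.onOb := by
  rw [Und.isVTerminal_iff]
  -- objects `1 ⟶ [X, A₀]` correspond to maps `X ⟶ A₀`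
  let e : (X ⟶ A.ob) ≃ GenElt X A :=
    { toFun b := ⟨MonoidalClosed.curry (A := X) (Y := 𝟙_ V) (X := A.ob) (fst X (𝟙_ V) ≫ b)⟩
      invFun a := MonoidalClosed.uncurry' (X := X) (Y := A.ob) a.elt
      left_inv b := by
        simp [MonoidalClosed.uncurry']
      right_inv a := by
        obtain ⟨a⟩ := a
        refine congrArg Und.mk ?_
        refine (MonoidalClosed.curry_eq_iff (A := X) (X := A.ob) (Y := 𝟙_ V) _ _).2 ?_
        rw [← rightUnitor_hom]
        exact Iso.hom_inv_id_assoc (ρ_ X) _ }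
  rw [← e.forall_congr_right]
  refine forall_congr' fun b => forall_congr' fun W => ?_
  have hm (m : W ⟶ (ihom X).obj A.mor) :
      (m ≫ (ihom X).map A.src = toUnit W ≫ (e b).elt ∧
        m ≫ (ihom X).map A.tgt = toUnit W ≫ (GenElt.ofElement X T).elt) ↔
      (MonoidalClosed.uncurry m ≫ A.src = fst X W ≫ b ∧
        MonoidalClosed.uncurry m ≫ A.tgt = toUnit (X ⊗ W) ≫ T.onOb) := by
    rw [GenElt.ofElement_elt]
    refine and_congr ((comp_ihom_map_eq_iff m A.src _).trans ?_)
      ((comp_ihom_map_eq_iff m A.tgt _).trans ?_)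
    · rw [whiskerLeft_fst_assoc]
    · rw [toUnit_unique (toUnit (X ⊗ W)) (X ◁ toUnit W ≫ snd X (𝟙_ V))]
      exact iff_of_eq (congrArg (MonoidalClosed.uncurry m ≫ A.tgt = ·) (Category.assoc _ _ _).symm)
  let E := (ihom.adjunction X).homEquiv W A.mor
  refine Iff.trans (existsUnique_congr fun m => hm m) ?_
  exact E.symm.existsUnique_congr (fun _ => Iff.rfl)

theorem GenElt.existsUnique_of_isVTerminal {X : V} {A : InternalCat V}
    {T : 𝟙_ (InternalCat V) ⟶ A} (h : IsVTerminal (V := V) (GenElt.ofElement X T))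
    (b : X ⟶ A.ob) : ∃! m : X ⟶ A.mor, m ≫ A.src = b ∧ m ≫ A.tgt = toUnit X ≫ T.onOb := by
  -- the stage `W = 1`, transported along `X × 1 ≅ X`
  obtain ⟨m, ⟨hs, ht⟩, hm⟩ := (isVTerminal_ofElement_iff X T).1 h b (𝟙_ V)
  rw [← rightUnitor_hom] at hs hm
  refine ⟨(ρ_ X).inv ≫ m, ⟨?_, ?_⟩, fun n hn => ?_⟩
  · rw [Category.assoc, hs, Iso.inv_hom_id_assoc]
  · rw [Category.assoc, ht]
    exact comp_toUnit_assoc _ _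
  · rw [← hm ((ρ_ X).hom ≫ n) ⟨?_, ?_⟩, Iso.inv_hom_id_assoc]
    · rw [Category.assoc, hn.1]
    · rw [Category.assoc, hn.2]
      exact comp_toUnit_assoc _ _

end Terminal

/-! ### Morphisms into `(c, x)` in the category of elements -/

section Elements

open Elements

variable {V : Type u} [Category.{v} V] [CartesianMonoidalCategory V] [BraidedCategory V]
  [MonoidalClosed V] [HasCoproducts.{w} V] {C : Type w} [EnrichedCategory V C]
  (F : EnrichedFunctor V Cᵒᵖ V) {c : C} (x : 𝟙_ V ⟶ F.obj (op c))

namespace Elements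

theorem mkMor_toUnit_src {W : V} {A : C} (f : W ⟶ EnrichedCategory.Hom A c) :
    mkMor f (toUnit W ≫ x) ≫ src F = (f ≫ yonedaApp F c x A) ≫ ιOb F A := by
  rw [mkMor_src, comp_yonedaApp]

variable [IsExtensive.{w} V]

/-- If two maps into summands of `∐_A F A` agree after the inclusions, then statements about maps
out of their domain may be proved assuming that the two summands are the same: otherwise the
domain is initial. -/
theorem eq_of_ιOb_eq {W T : V} {A B : C} {y : W ⟶ F.obj (op A)} {y' : W ⟶ F.obj (op B)}
    (h : y ≫ ιOb F A = y' ≫ ιOb F B) {a b : W ⟶ T} (H : A = B → a = b) : a = b := by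
  by_cases hAB : A = B
  · exact H hAB
  · obtain ⟨_⟩ := ιOb_eq F h hAB T
    exact Subsingleton.elim _ _

/-- A morphism into `(c, x)` is determined by its source if all the maps `C(A, c) ⟶ F A` are
monomorphisms. -/
theorem mor_ext_of_mono [∀ A, Mono (yonedaApp F c x A)] {Y : V} {m n : Y ⟶ mor F}
    (hs : m ≫ src F = n ≫ src F) (hm : m ≫ tgt F = toUnit Y ≫ x ≫ ιOb F c)
    (hn : n ≫ tgt F = toUnit Y ≫ x ≫ ιOb F c) : m = n := by
  -- cover `Y` by pieces on which both `m` and `n` factor through a single summand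
  refine mor_cover F m fun W z A B f y hz => ?_
  refine mor_cover F (z ≫ n) fun W' z' A' B' f' y' hz' => ?_
  have hz₀ : (z' ≫ z) ≫ m = mkMor (z' ≫ f) (z' ≫ y) := by rw [Category.assoc, hz, comp_mkMor]
  have hz₁ : (z' ≫ z) ≫ n = mkMor f' y' := by rw [Category.assoc, hz']
  rw [← Category.assoc, ← Category.assoc]
  have eB : (z' ≫ y) ≫ ιOb F B = (toUnit W' ≫ x) ≫ ιOb F c := by
    rw [← mkMor_tgt (z' ≫ f), ← hz₀, Category.assoc, hm, comp_toUnit_assoc, Category.assoc]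
  have eB' : y' ≫ ιOb F B' = (toUnit W' ≫ x) ≫ ιOb F c := by
    rw [← mkMor_tgt f', ← hz₁, Category.assoc, hn, comp_toUnit_assoc, Category.assoc]
  refine eq_of_ιOb_eq F eB ?_
  rintro rfl
  refine eq_of_ιOb_eq F eB' ?_
  rintro rfl
  rw [ιOb_cancel F eB] at hz₀
  rw [ιOb_cancel F eB'] at hz₁
  have eA : ((z' ≫ f) ≫ yonedaApp F _ x A) ≫ ιOb F A =
      (f' ≫ yonedaApp F _ x A') ≫ ιOb F A' := by
    rw [← mkMor_toUnit_src, ← mkMor_toUnit_src, ← hz₀, ← hz₁, Category.assoc, hs, Category.assoc,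
      Category.assoc, Category.assoc]
  refine eq_of_ιOb_eq F eA ?_
  rintro rfl
  rw [hz₀, hz₁, (cancel_mono _).1 (ιOb_cancel F eA)]

/-- A morphism from `(A, y)` to `(c, x)` yields a factorization of `y` through
`C(A, c) ⟶ F A`. -/
theorem exists_yonedaApp_eq {Y : V} {A : C} (y : Y ⟶ F.obj (op A)) (m : Y ⟶ mor F)
    (hs : m ≫ src F = y ≫ ιOb F A) (ht : m ≫ tgt F = toUnit Y ≫ x ≫ ιOb F c) :
    ∃ f : Y ⟶ EnrichedCategory.Hom A c, f ≫ yonedaApp F c x A = y := by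
  refine exists_lift_of_cover (Y := morFam F) m _ _ fun p W z g hz => ?_
  obtain ⟨A', B⟩ := p
  have hz₀ : z ≫ m = mkMor (g ≫ fst _ _) (g ≫ snd _ _) := hz.trans (comp_ιMor F g)
  have eB : (g ≫ snd _ _) ≫ ιOb F B = (toUnit W ≫ x) ≫ ιOb F c := by
    rw [← mkMor_tgt (g ≫ fst _ _), ← hz₀, Category.assoc, ht, comp_toUnit_assoc, Category.assoc]
  by_cases hB : B = c
  · subst hB
    rw [ιOb_cancel F eB] at hz₀
    have eA : ((g ≫ fst _ _) ≫ yonedaApp F _ x A') ≫ ιOb F A' = (z ≫ y) ≫ ιOb F A := by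
      rw [← mkMor_toUnit_src, ← hz₀, Category.assoc, hs, Category.assoc]
    by_cases hA : A' = A
    · subst hA
      exact ⟨g ≫ fst _ _, ιOb_cancel F eA⟩
    · obtain ⟨_⟩ := ιOb_eq F eA hA (EnrichedCategory.Hom A B)
      obtain ⟨_⟩ := ιOb_eq F eA hA (F.obj (op A))
      exact ⟨default, Subsingleton.elim _ _⟩
  · obtain ⟨_⟩ := ιOb_eq F eB hB (EnrichedCategory.Hom A c)
    obtain ⟨_⟩ := ιOb_eq F eB hB (F.obj (op A))
    exact ⟨default, Subsingleton.elim _ _⟩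

/-- If the maps `C(A, c) ⟶ F A` are invertible, then every generalized element of `∫ F` has a
unique morphism to `(c, x)`. -/
theorem existsUnique_mor [∀ A, IsIso (yonedaApp F c x A)] {Y : V} (b : Y ⟶ ob F) :
    ∃! m : Y ⟶ mor F, m ≫ src F = b ∧ m ≫ tgt F = toUnit Y ≫ x ≫ ιOb F c := by
  let n : ob F ⟶ mor F := descOb F fun A => mkMor (inv (yonedaApp F c x A)) (toUnit _ ≫ x)
  have hs : n ≫ src F = 𝟙 _ := ob_hom_ext F fun A => by
    rw [← Category.assoc, ιOb_desc, mkMor_toUnit_src, IsIso.inv_hom_id, Category.id_comp,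
      Category.comp_id]
  have ht : n ≫ tgt F = toUnit _ ≫ x ≫ ιOb F c := ob_hom_ext F fun A => by
    rw [← Category.assoc, ιOb_desc, mkMor_tgt, comp_toUnit_assoc, Category.assoc]
  have hbs : (b ≫ n) ≫ src F = b := by rw [Category.assoc, hs, Category.comp_id]
  have hbt : (b ≫ n) ≫ tgt F = toUnit Y ≫ x ≫ ιOb F c := by
    rw [Category.assoc, ht, comp_toUnit_assoc]
  exact ⟨b ≫ n, ⟨hbs, hbt⟩, fun m hm => mor_ext_of_mono F x (hm.1.trans hbs.symm) hm.2 hbt⟩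

/-- If every generalized element of `∫ F` of shape `X` has a unique morphism to `(c, x)`, then
composition with `C(A, c) ⟶ F A` is bijective on generalized elements of shape `X`. -/
theorem bijective_comp_yonedaApp {X : V} (h : ∀ b : X ⟶ ob F, ∃! m : X ⟶ mor F,
      m ≫ src F = b ∧ m ≫ tgt F = toUnit X ≫ x ≫ ιOb F c) (A : C) :
    Function.Bijective fun f : X ⟶ EnrichedCategory.Hom A c => f ≫ yonedaApp F c x A := by
  constructor
  · intro f f' hf
    refine (mkMor_cancel F ((h ((f ≫ yonedaApp F c x A) ≫ ιOb F A)).unique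
      (y₁ := mkMor f (toUnit X ≫ x)) (y₂ := mkMor f' (toUnit X ≫ x)) ⟨?_, ?_⟩ ⟨?_, ?_⟩)).1
    · rw [mkMor_toUnit_src]
    · rw [mkMor_tgt, Category.assoc]
    · rw [mkMor_toUnit_src]
      exact congrArg (· ≫ ιOb F A) hf.symm
    · rw [mkMor_tgt, Category.assoc]
  · intro y
    obtain ⟨m, ⟨hs, ht⟩, -⟩ := h (y ≫ ιOb F A)
    exact exists_yonedaApp_eq F x y m hs ht

end Elements

end Elements

end VRep

/-! ### Representability and terminality -/

theorem mainTheorem5 {V : Type u} [Category.{v} V] [CartesianMonoidalCategory V]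
    [BraidedCategory V] [MonoidalClosed V] [HasPullbacks V] [HasCoproducts.{w} V]
    [VRep.IsExtensive.{w} V] (G : Set V) (hG : VRep.IsConservativeFamily G)
    {C : Type w} [EnrichedCategory V C] (F : EnrichedFunctor V Cᵒᵖ V) (c : C)
    (x : 𝟙_ V ⟶ F.obj (op c)) :
    VRep.IsVRepresentableBy F c x ↔
      ∀ X ∈ G, VRep.IsVTerminal (V := V)
        (VRep.GenElt.ofElement X (VRep.elementsPair F c x)) := by
  rw [VRep.isVRepresentableBy_iff]
  constructor
  · intro h X _
    rw [VRep.GenElt.isVTerminal_ofElement_iff]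
    intro b W
    exact VRep.Elements.existsUnique_mor F x (fst X W ≫ b)
  · intro h A
    exact (hG _).2 fun X hX => VRep.Elements.bijective_comp_yonedaApp F x
      (VRep.GenElt.existsUnique_of_isVTerminal (h X hX)) A
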